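/- Let $G$ be a Lie group and let $\mathbb{V}$ be a finite-dimensional real inner product space with an orthogonal representation of $G$. Let $M=G/K\subset\mathbb{V}$ be a $G$-orbit that is a compact smooth submanifold and, with the metric induced from $\mathbb{V}$, a Riemannian symmetric space (for every $y\in M$ there is an isometry of $M$ that fixes $y$ and has differential $-\mathrm{id}$ on $T_yM$). For $u\in\mathbb{V}$ let $V_u$ be the vector field on $M$ whose value at $y$ is the orthogonal projection of $u$ onto $T_yM$. For a vector field $V$ on $M$ with flow $\phi_t$ and an orthonormal $p$-frame $\xi=e_1\wedge\dots\wedge e_p$ of $T_xM$, let \[ \mathcal{Q}_\xi(V):=\left.\frac{\mathrm{d}^2}{\mathrm{d}t^2}\right|_{t=0}\big\|(\phi_t)_*\xi\big\| ,\qquad (\phi_t)_*\xi=(\mathrm{d}\phi_t)_xe_1\wedge\dots\wedge(\mathrm{d}\phi_t)_xe_p , \] where $\|w_1\wedge\dots\wedge w_p\|=\det(\langle w_i,w_j\rangle)^{1/2}$. Let $x\in M$ and let $\{e_1,\dots,e_p,n_1,\dots,n_q\}$ be an orthonormal basis of $T_xM$; put $\xi=e_1\wedge\dots\wedge e_p$.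 Then each field $V_u$ has a flow defined for all times, $t\mapsto\|(\phi_t)_*\xi\|$ is twice continuously differentiable near $t=0$, and for every orthonormal basis $(u_i)$ of $\mathbb{V}$ \[ \sum_i\mathcal{Q}_\xi(V_{u_i})=\sum_{j=1}^{p}\sum_{k=1}^{q}\Big(2\,\|\mathrm{II}(e_j,n_k)\|^2-\big\langle \mathrm{II}(e_j,e_j),\mathrm{II}(n_k,n_k)\big\rangle\Big), \] where $\mathrm{II}$ is the second fundamental form of $M\subset\mathbb{V}$ at $x$, i.e. $\mathrm{II}(X,Y)$ is the component normal to $T_xM$ of the derivative in $\mathbb{V}$, along $X$, of a tangent vector field on $M$ extending $Y$. -/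

import Mathlib

open scoped Manifold ContDiff InnerProductSpace

noncomputable section

namespace SymmetricOrbit

variable {V : Type*} [NormedAddCommGroup V] [InnerProductSpace ℝ V] [FiniteDimensional ℝ V]
  {E : Type*} [NormedAddCommGroup E] [NormedSpace ℝ E]
  {M : Type*} [TopologicalSpace M] [ChartedSpace E M]

/-- The differential at `y` of a map `f : M → V` into a vector space, with values in `V`
itself. For an immersion it identifies `T_y M` with a linear subspace of `V`. -/
def tangentMap (f : M → V) (y : M) : TangentSpace 𝓘(ℝ, E) y →L[ℝ] V :=
  mfderiv 𝓘(ℝ, E) 𝓘(ℝ, V) f y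

/-- The tangent space of the submanifold `f(M) ⊂ V` at `f y`, as a subspace of `V`. -/
def tangentSubspace (f : M → V) (y : M) : Submodule ℝ V :=
  LinearMap.range (tangentMap (E := E) f y).toLinearMap

/-- The metric on `M` induced by the inner product of `V` along `f`. -/
def inducedInner (f : M → V) (y : M) (v w : TangentSpace 𝓘(ℝ, E) y) : ℝ :=
  ⟪tangentMap f y v, tangentMap f y w⟫_ℝ

/-- `f` is an injective smooth immersion; on a compact manifold this is a smooth embedding. -/
structure IsInjectiveImmersion (f : M → V) : Prop where
  contMDiff : ContMDiff 𝓘(ℝ, E) 𝓘(ℝ, V) ∞ f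
  injective : Function.Injective f
  injective_tangentMap : ∀ y : M, Function.Injective (tangentMap (E := E) f y)

/-- `M` with the metric induced by `f` is a Riemannian (globally) symmetric space: around every
point `y` there is an isometry of `M` that fixes `y` and has differential `-id` there. -/
def IsRiemannianSymmetric (f : M → V) : Prop :=
  ∀ y : M, ∃ s : M ≃ₘ^∞⟮𝓘(ℝ, E), 𝓘(ℝ, E)⟯ M,
    (∀ (z : M) (v w : TangentSpace 𝓘(ℝ, E) z),
      inducedInner (E := E) f (s z) (mfderiv 𝓘(ℝ, E) 𝓘(ℝ, E) s z v)
        (mfderiv 𝓘(ℝ, E) 𝓘(ℝ, E) s z w) = inducedInner (E := E) f z v w) ∧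
    s y = y ∧
    ∀ v : E, (mfderiv 𝓘(ℝ, E) 𝓘(ℝ, E) s y v : E) = -v

theorem exists_tangentMap_eq (f : M → V) (u : V) (y : M) :
    ∃ v : TangentSpace 𝓘(ℝ, E) y,
      tangentMap f y v = (tangentSubspace (E := E) f y).starProjection u :=
  Submodule.starProjection_apply_mem (tangentSubspace (E := E) f y) u

/-- The vector field `V_u` on `M`: at `y` it is the tangent vector whose image in `V` is the
orthogonal projection of `u` onto the tangent space of `f(M)` at `f y`
(there is exactly one if `f` is an immersion). -/
def projField (f : M → V) (u : V) (y : M) : TangentSpace 𝓘(ℝ, E) y :=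
  (exists_tangentMap_eq f u y).choose

/-- The second fundamental form of `f(M) ⊂ V` at `x`: the normal component of the derivative in
`V` along `X` of the vector field that extends `Y` with constant coefficients in the chart at `x`.
(A vector of `TangentSpace 𝓘(ℝ, E) x` is the vector of its coefficients in this chart.) -/
def secondFundamentalForm (f : M → V) (x : M) (X Y : TangentSpace 𝓘(ℝ, E) x) : V :=
  (tangentSubspace (E := E) f x)ᗮ.starProjection
    (fderiv ℝ (fun z : E => fderiv ℝ (f ∘ (extChartAt 𝓘(ℝ, E) x).symm) z Y)
      (extChartAt 𝓘(ℝ, E) x x) X)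

open Classical in
/-- The flow `φ_t` of a vector field: `t ↦ flow v t y` is the integral curve that starts at `y`.
(A smooth field on a compact manifold has exactly one; `y` is a default value otherwise.) -/
def flow (v : (y : M) → TangentSpace 𝓘(ℝ, E) y) (t : ℝ) (y : M) : M :=
  if h : ∃ γ : ℝ → M, γ 0 = y ∧ IsMIntegralCurve (I := 𝓘(ℝ, E)) γ v then h.choose t else y

/-- The norm `‖w_1 ∧ ⋯ ∧ w_p‖` in `Λ^p T_y M` for the induced metric:
the square root of the Gram determinant. -/
def wedgeNorm (f : M → V) {p : ℕ} (y : M) (w : Fin p → TangentSpace 𝓘(ℝ, E) y) : ℝ :=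
  Real.sqrt (Matrix.of fun i j => inducedInner (E := E) f y (w i) (w j)).det

/-- `t ↦ ‖(φ_t)_* ξ‖` for the flow `φ_t` of the field `v` and `ξ = e_1 ∧ ⋯ ∧ e_p` at `x`. -/
def pushforwardNorm (f : M → V) (v : (y : M) → TangentSpace 𝓘(ℝ, E) y) {p : ℕ} (x : M)
    (e : Fin p → TangentSpace 𝓘(ℝ, E) x) (t : ℝ) : ℝ :=
  wedgeNorm (E := E) f (flow v t x) fun j => mfderiv 𝓘(ℝ, E) 𝓘(ℝ, E) (flow v t) x (e j)

/-- The second variation `Q_ξ(v) = d²/dt²|_{t=0} ‖(φ_t)_* ξ‖`. -/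
def secondVariation (f : M → V) (v : (y : M) → TangentSpace 𝓘(ℝ, E) y) {p : ℕ} (x : M)
    (e : Fin p → TangentSpace 𝓘(ℝ, E) x) : ℝ :=
  iteratedDeriv 2 (pushforwardNorm (E := E) f v x e) 0

end SymmetricOrbit

end

/-! Near `x` write the immersion as a map F on the chart, with differential A. Put L = (AᵀA)⁻¹Aᵀ, so
that P = AL is the orthogonal projection onto the tangent space. In the chart the field V_u is Lu.
Let w(t) be the image in V of a frame vector carried by its flow. The product rule and the symmetry
of d²F show that w' is the derivative of Pu along the carried vector (`hasDerivAt_pushforward`), and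
one more derivative gives w''.

The Gram matrix G of the carried frame is 1 at time 0, where √det G has second derivative (tr G'' -
tr G'²)/2 + (tr G')²/4 (`iteratedDeriv_two_sqrt_det`). Since dP(X)(AY) = II(X,Y), the entries of G'
are 2⟨u, II(e_i,e_j)⟩.

Summing over an orthonormal basis of V turns everything into traces. The relations obtained by
differentiating P² = P, Pᵀ = P, PA = A and AL = P (`IsProjectionJet`) convert the terms from G''
into the sum of 2‖II(e_j,g)‖² - ⟨II(e_j,e_j), II(g,g)⟩ over j and over an orthonormal basis g of
T_xM. The terms from (tr G')² and tr G'² cancel exactly the part with g among the e_k, and the part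
with g among the n_k remains (`sum_secondVariation`).

The analytic input concerns `flow`, which is chosen separately for each starting point. A Grönwall
estimate makes a local flow differentiable in its initial value (`exists_localFlow`), uniqueness of
integral curves identifies it with `flow`, and compactness makes the fields complete. -/

noncomputable section

namespace SymmetricOrbit

open Set Filter Topology

/-! ### Local flows and their derivative in the initial value. -/

section LocalFlow

variable {E : Type*} [NormedAddCommGroup E] [NormedSpace ℝ E]

/-- Near a point where it is `C²`, a map is Lipschitz and its first order Taylor expansion has a
quadratic remainder, both uniformly. -/
theorem exists_ball_lipschitzOnWith_norm_sub_fderiv_le {W : E → E} {z₀ : E}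
    (hW : ContDiffAt ℝ 2 W z₀) :
    ∃ ρ > 0, ∃ K C : NNReal, LipschitzOnWith K W (Metric.ball z₀ ρ) ∧
      ∀ z ∈ Metric.ball z₀ ρ, ∀ z' ∈ Metric.ball z₀ ρ,
        ‖W z' - W z - fderiv ℝ W z (z' - z)‖ ≤ C * ‖z' - z‖ ^ 2 := by
  obtain ⟨K, s, hs, hK⟩ := (hW.of_le one_le_two).exists_lipschitzOnWith
  have hW1 : ContDiffAt ℝ 1 (fderiv ℝ W) z₀ := hW.fderiv_right (m := 1) (by norm_num)
  obtain ⟨C, s', hs', hC⟩ := hW1.exists_lipschitzOnWith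
  have hd : ∀ᶠ z in 𝓝 z₀, DifferentiableAt ℝ W z :=
    (hW.eventually (by simp)).mono fun z hz => hz.differentiableAt (by simp)
  obtain ⟨ρ, hρ, hball⟩ := Metric.mem_nhds_iff.mp (inter_mem (inter_mem hs hs') hd)
  refine ⟨ρ, hρ, K, C, hK.mono fun z hz => (hball hz).1.1, fun z hz z' hz' => ?_⟩
  have hseg : segment ℝ z z' ⊆ Metric.ball z₀ ρ := (convex_ball z₀ ρ).segment_subset hz hz'
  -- Mean value inequality on the segment: there the derivative differs from its value at `z` by at
  -- most `C * ‖z' - z‖`, as `C` is a Lipschitz constant of the derivative.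
  have := Convex.norm_image_sub_le_of_norm_fderiv_le' (𝕜 := ℝ) (f := W) (s := segment ℝ z z')
    (φ := fderiv ℝ W z) (C := C * ‖z' - z‖) (fun y hy => (hball (hseg hy)).2)
    (fun y hy => by
      have h1 := hC.norm_sub_le (hball (hseg hy)).1.2 (hball hz).1.2
      refine h1.trans ?_
      gcongr
      exact norm_sub_le_of_mem_segment hy)
    (convex_segment z z') (left_mem_segment ℝ z z') (right_mem_segment ℝ z z')
  calc _ ≤ _ := this
    _ = _ := by ring

/-- The linearised solution `γ + D h` of an autonomous equation stays quadratically close to the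
true solution `α` with the same initial value. -/
theorem norm_sub_linearization_le {W : E → E} {W' : E → E →L[ℝ] E} {s : Set E}
    {K C : NNReal} (hK : LipschitzOnWith K W s)
    (hC : ∀ z ∈ s, ∀ z' ∈ s, ‖W z' - W z - W' z (z' - z)‖ ≤ C * ‖z' - z‖ ^ 2)
    {γ α : ℝ → E} {D : ℝ → E →L[ℝ] E} {h : E} {T : ℝ} (hT : 0 ≤ T)
    (hγ : ∀ t ∈ Icc 0 T, HasDerivAt γ (W (γ t)) t)
    (hα : ∀ t ∈ Icc 0 T, HasDerivAt α (W (α t)) t)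
    (hD : ∀ t ∈ Icc 0 T, HasDerivAt D (W' (γ t) ∘L D t) t)
    (hγs : ∀ t ∈ Icc 0 T, γ t ∈ s) (hαs : ∀ t ∈ Icc 0 T, α t ∈ s)
    (hDs : ∀ t ∈ Icc 0 T, γ t + D t h ∈ s) (hD2 : ∀ t ∈ Icc 0 T, ‖D t‖ ≤ 2)
    (h0 : α 0 = γ 0 + D 0 h) :
    ‖α T - γ T - D T h‖ ≤ gronwallBound 0 K (C * (2 * ‖h‖) ^ 2) T := by
  have hlin : ∀ t ∈ Icc 0 T, HasDerivAt (fun t => γ t + D t h) (W (γ t) + W' (γ t) (D t h)) t :=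
    fun t ht => (hγ t ht).add ((hD t ht).clm_apply (hasDerivAt_const t h) |>.congr_deriv (by simp))
  -- Grönwall: `α` is an exact solution, and `γ + D h` solves the equation up to the Taylor
  -- remainder `C * ‖D h‖ ^ 2`.
  have := dist_le_of_approx_trajectories_ODE_of_mem (v := fun _ => W) (s := fun _ => s)
    (K := K) (f := α) (g := fun t => γ t + D t h) (f' := fun t => W (α t))
    (g' := fun t => W (γ t) + W' (γ t) (D t h)) (a := 0) (b := T) (εf := 0)
    (εg := C * (2 * ‖h‖) ^ 2) (δ := 0) (fun _ _ => hK)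
    (fun t ht => (hα t ht).continuousAt.continuousWithinAt)
    (fun t ht => (hα t (Ico_subset_Icc_self ht)).hasDerivWithinAt) (by simp)
    (fun t ht => hαs t (Ico_subset_Icc_self ht))
    (fun t ht => (hlin t ht).continuousAt.continuousWithinAt)
    (fun t ht => (hlin t (Ico_subset_Icc_self ht)).hasDerivWithinAt)
    (fun t ht => by
      have ht' := Ico_subset_Icc_self ht
      have h1 := hC (γ t) (hγs t ht') (γ t + D t h) (hDs t ht')
      rw [add_sub_cancel_left] at h1
      rw [dist_eq_norm, ← norm_neg]
      calc _ = ‖W (γ t + D t h) - W (γ t) - W' (γ t) (D t h)‖ := by congr 1; abel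
        _ ≤ C * ‖D t h‖ ^ 2 := h1
        _ ≤ C * (2 * ‖h‖) ^ 2 := by
          gcongr
          exact (D t).le_of_opNorm_le (hD2 t ht') h)
    (fun t ht => hDs t (Ico_subset_Icc_self ht)) (by simp [h0]) T ⟨hT, le_rfl⟩
  simpa [dist_eq_norm, sub_sub] using this

/-- Two-sided version of `norm_sub_linearization_le`. -/
theorem norm_sub_linearization_le_abs {W : E → E} {W' : E → E →L[ℝ] E} {s : Set E}
    {K C : NNReal} (hK : LipschitzOnWith K W s)
    (hC : ∀ z ∈ s, ∀ z' ∈ s, ‖W z' - W z - W' z (z' - z)‖ ≤ C * ‖z' - z‖ ^ 2)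
    {γ α : ℝ → E} {D : ℝ → E →L[ℝ] E} {h : E} {ε : ℝ}
    (hγ : ∀ t ∈ Ioo (-ε) ε, HasDerivAt γ (W (γ t)) t)
    (hα : ∀ t ∈ Ioo (-ε) ε, HasDerivAt α (W (α t)) t)
    (hD : ∀ t ∈ Ioo (-ε) ε, HasDerivAt D (W' (γ t) ∘L D t) t)
    (hγs : ∀ t ∈ Ioo (-ε) ε, γ t ∈ s) (hαs : ∀ t ∈ Ioo (-ε) ε, α t ∈ s)
    (hDs : ∀ t ∈ Ioo (-ε) ε, γ t + D t h ∈ s) (hD2 : ∀ t ∈ Ioo (-ε) ε, ‖D t‖ ≤ 2)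
    (h0 : α 0 = γ 0 + D 0 h) {T : ℝ} (hT : T ∈ Ioo (-ε) ε) :
    ‖α T - γ T - D T h‖ ≤ gronwallBound 0 K (C * (2 * ‖h‖) ^ 2) |T| := by
  rcases le_total 0 T with hT0 | hT0
  · have hsub : Icc 0 T ⊆ Ioo (-ε) ε := fun t ht => ⟨by linarith [hT.2, ht.1], ht.2.trans_lt hT.2⟩
    rw [abs_of_nonneg hT0]
    exact norm_sub_linearization_le hK hC hT0 (fun t ht => hγ t (hsub ht))
      (fun t ht => hα t (hsub ht)) (fun t ht => hD t (hsub ht)) (fun t ht => hγs t (hsub ht))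
      (fun t ht => hαs t (hsub ht)) (fun t ht => hDs t (hsub ht)) (fun t ht => hD2 t (hsub ht)) h0
  · have hsub : ∀ t ∈ Icc 0 (-T), -t ∈ Ioo (-ε) ε :=
      fun t ht => ⟨by linarith [hT.1, ht.2], by linarith [hT.1, ht.1]⟩
    have hneg : ∀ {F : Type _} [NormedAddCommGroup F] [NormedSpace ℝ F] {c : ℝ → F} {c' : F}
        {t : ℝ}, HasDerivAt c c' (-t) → HasDerivAt (fun t => c (-t)) (-c') t := by
      intro F _ _ c c' t hc
      exact (hc.scomp t (hasDerivAt_neg t)).congr_deriv (neg_one_smul ℝ c')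
    rw [abs_of_nonpos hT0]
    -- Reversing time replaces `W` by `-W` and reduces to nonnegative times.
    have := norm_sub_linearization_le (W := fun z => -W z) (W' := fun z => -W' z) (s := s)
      (K := K) (C := C) (γ := fun t => γ (-t)) (α := fun t => α (-t)) (D := fun t => D (-t))
      (h := h) (T := -T)
      (fun z hz z' hz' => by simpa [edist_neg_neg] using hK hz hz')
      (fun z hz z' hz' => by
        refine le_trans (le_of_eq ?_) (hC z hz z' hz')
        rw [← norm_neg]; congr 1; simp only [neg_apply]; abel)
      (by linarith) (fun t ht => hneg (hγ _ (hsub t ht))) (fun t ht => hneg (hα _ (hsub t ht)))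
      (fun t ht => (hneg (hD _ (hsub t ht))).congr_deriv (by
        ext; simp))
      (fun t ht => hγs _ (hsub t ht)) (fun t ht => hαs _ (hsub t ht))
      (fun t ht => hDs _ (hsub t ht)) (fun t ht => hD2 _ (hsub t ht)) (by simpa using h0)
    simpa using this

/-- With no initial error the bound is linear in the defect, so the factor `‖h‖ ^ 2` comes out with
a constant depending only on the time. -/
theorem gronwallBound_zero_left {K : NNReal} {ε x : ℝ} :
    gronwallBound 0 K ε x = ε * gronwallBound 0 K 1 x := by
  unfold gronwallBound
  split_ifs <;> simp; ring

/-- A curve that solves an autonomous smooth equation is smooth. -/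
theorem contDiffAt_of_hasDerivAt {Z : E → E} {c : ℝ → E} {t₀ : ℝ}
    (hZ : ContDiffAt ℝ ∞ Z (c t₀)) (hc : ∀ᶠ t in 𝓝 t₀, HasDerivAt c (Z (c t)) t) (n : ℕ) :
    ContDiffAt ℝ n c t₀ := by
  induction n with
  | zero =>
    rw [Nat.cast_zero, contDiffAt_zero]
    exact ⟨_, hc, fun t ht => (HasDerivAt.continuousAt ht).continuousWithinAt⟩
  | succ n ih =>
    -- Bootstrap: if `c` is `C^n`, so is its derivative `Z ∘ c`.
    have hZc : ContDiffAt ℝ n (fun t => Z (c t)) t₀ :=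
      ContDiffAt.comp t₀ (hZ.of_le (by exact_mod_cast le_top)) ih
    rw [Nat.cast_add, Nat.cast_one, contDiffAt_succ_iff_hasFDerivAt]
    exact ⟨fun t => ContinuousLinearMap.toSpanSingleton ℝ (Z (c t)), ⟨_, hc, fun t ht =>
      HasDerivAt.hasFDerivAt ht⟩,
      (ContinuousLinearMap.toSpanSingletonCLE (𝕜 := ℝ) (E := E)).contDiff.contDiffAt.comp t₀ hZc⟩

/-- The equation of first variation of `z' = W z`, together with the equation itself. -/
def variationField (W : E → E) (p : E × (E →L[ℝ] E)) : E × (E →L[ℝ] E) :=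
  (W p.1, fderiv ℝ W p.1 ∘L p.2)

theorem contDiffAt_variationField {W : E → E} {p : E × (E →L[ℝ] E)}
    (hW : ContDiffAt ℝ ∞ W p.1) : ContDiffAt ℝ ∞ (variationField W) p := by
  have hW' : ContDiffAt ℝ ∞ (fderiv ℝ W) p.1 := hW.fderiv_right (by simp)
  exact (hW.comp p contDiffAt_fst).prodMk ((hW'.comp p contDiffAt_fst).clm_comp contDiffAt_snd)

/-- A smooth vector field has a local flow `Φ`, whose derivative `D t` in the initial value at
`z₀` exists and solves the equation of first variation. -/
theorem exists_localFlow [CompleteSpace E] {W : E → E} {z₀ : E} (hW : ContDiffAt ℝ ∞ W z₀)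
    {U : Set E} (hU : U ∈ 𝓝 z₀) :
    ∃ ε > 0, ∃ N ∈ 𝓝 z₀, ∃ (Φ : E → ℝ → E) (D : ℝ → E →L[ℝ] E),
      (∀ z ∈ N, Φ z 0 = z ∧ ∀ t ∈ Ioo (-ε) ε, HasDerivAt (Φ z) (W (Φ z t)) t ∧ Φ z t ∈ U) ∧
      D 0 = ContinuousLinearMap.id ℝ E ∧
      ∀ t ∈ Ioo (-ε) ε, HasDerivAt D (fderiv ℝ W (Φ z₀ t) ∘L D t) t ∧
        HasFDerivAt (fun z => Φ z t) (D t) z₀ := by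
  obtain ⟨ρ, hρ, K, C, hK, hC⟩ :=
    exists_ball_lipschitzOnWith_norm_sub_fderiv_le
      (hW.of_le ENat.LEInfty.out)
  obtain ⟨ε₁, hε₁, a, r, _, _, hr, hpl⟩ :=
    IsPicardLindelof.of_contDiffAt_one (hW.of_le (by exact_mod_cast le_top))
  obtain ⟨α, hα, hαc⟩ := (hpl 0).exists_forall_mem_closedBall_eq_hasDerivWithinAt_continuousOn
  simp only [zero_sub, zero_add] at hα hαc
  have hr' : (0 : ℝ) < r := hr
  have hz₀r := Metric.mem_closedBall_self (x := z₀) hr'.le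
  have hα0 : α (z₀, 0) = z₀ := (hα z₀ hz₀r).1
  have hcont : ContinuousAt α (z₀, 0) := hαc.continuousAt
    (prod_mem_nhds (Metric.closedBall_mem_nhds z₀ hr') (Icc_mem_nhds (by simpa) hε₁))
  have hmem : ∀ᶠ p in 𝓝 (z₀, (0 : ℝ)), α p ∈ U ∩ Metric.ball z₀ (ρ / 2) := by
    refine hcont.preimage_mem_nhds ?_
    rw [hα0]
    exact inter_mem hU (Metric.ball_mem_nhds z₀ (by positivity))
  rw [nhds_prod_eq] at hmem
  obtain ⟨N₁, hN₁, I₁, hI₁, hNI⟩ := mem_prod_iff.mp hmem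
  have hαd : ∀ z ∈ Metric.closedBall z₀ r, ∀ t ∈ Ioo (-ε₁) ε₁,
      HasDerivAt (fun t => α (z, t)) (W (α (z, t))) t := fun z hz t ht =>
    ((hα z hz).2 t (Ioo_subset_Icc_self ht)).hasDerivAt (Icc_mem_nhds ht.1 ht.2)
  -- the equation of first variation along the central solution
  have hZ : ContDiffAt ℝ ∞ (variationField W) (z₀, ContinuousLinearMap.id ℝ E) :=
    contDiffAt_variationField hW
  obtain ⟨Γ, hΓ0, ε₂, hε₂, hΓ⟩ :=
    (hZ.of_le (by exact_mod_cast le_top :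
      (1 : WithTop ℕ∞) ≤ ∞)).exists_forall_mem_closedBall_exists_eq_forall_mem_Ioo_hasDerivAt₀ 0
  simp only [zero_sub, zero_add] at hΓ
  have hΓ0d := hΓ 0 (by simp [hε₂])
  have h1 : ∀ᶠ t in 𝓝 (0 : ℝ), HasDerivAt (fun t => (Γ t).1) (W (Γ t).1) t ∧
      (Γ t).1 ∈ Metric.ball z₀ ρ := by
    refine Eventually.and ?_ ?_
    · filter_upwards [Ioo_mem_nhds (neg_lt_zero.mpr hε₂) hε₂] with t ht
      exact (hΓ t ht).fst
    · refine hΓ0d.continuousAt.fst.preimage_mem_nhds ?_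
      simpa [hΓ0] using Metric.ball_mem_nhds z₀ hρ
  have h2 : ∀ᶠ t in 𝓝 (0 : ℝ), HasDerivAt (fun t => α (z₀, t)) (W (α (z₀, t))) t ∧
      α (z₀, t) ∈ Metric.ball z₀ ρ := by
    filter_upwards [Ioo_mem_nhds (neg_lt_zero.mpr hε₁) hε₁, hI₁] with t ht htI
    exact ⟨hαd z₀ hz₀r t ht,
      Metric.ball_subset_ball (by linarith) (hNI (mk_mem_prod (mem_of_mem_nhds hN₁) htI)).2⟩
  -- `Γ` and `α` come from separate existence theorems; uniqueness makes the base curve of `Γ` the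
  -- central solution, so `(Γ t).2` is the linearisation along `α`.
  have hΓα : ∀ᶠ t in 𝓝 (0 : ℝ), (Γ t).1 = α (z₀, t) :=
    ODE_solution_unique_of_eventually (v := fun _ => W) (s := fun _ => Metric.ball z₀ ρ)
      (Eventually.of_forall fun _ => hK) h1 h2 (by simp [hΓ0, hα0])
  have hD2 : ∀ᶠ t in 𝓝 (0 : ℝ), ‖(Γ t).2‖ < 2 := by
    have : ContinuousAt (fun t => ‖(Γ t).2‖) 0 := hΓ0d.continuousAt.snd.norm
    refine this.eventually_lt continuousAt_const ?_
    rw [hΓ0]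
    exact ContinuousLinearMap.norm_id_le.trans_lt one_lt_two
  obtain ⟨ε₃, hε₃, h3⟩ := Metric.eventually_nhds_iff_ball.mp (hΓα.and (hD2.and hI₁))
  simp only [Real.ball_eq_Ioo, zero_sub, zero_add] at h3
  have hlt : ∀ t ∈ Ioo (-min (min ε₁ ε₂) ε₃) (min (min ε₁ ε₂) ε₃),
      t ∈ Ioo (-ε₁) ε₁ ∧ t ∈ Ioo (-ε₂) ε₂ ∧ t ∈ Ioo (-ε₃) ε₃ := fun t ht => by
    rw [mem_Ioo, ← abs_lt, lt_min_iff, lt_min_iff] at ht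
    simp only [mem_Ioo, ← abs_lt]
    tauto
  have hDd : ∀ t ∈ Ioo (-min (min ε₁ ε₂) ε₃) (min (min ε₁ ε₂) ε₃),
      HasDerivAt (fun t => (Γ t).2) (fderiv ℝ W (α (z₀, t)) ∘L (Γ t).2) t := fun t ht => by
    rw [← (h3 t (hlt t ht).2.2).1]
    exact (hΓ t (hlt t ht).2.1).snd
  refine ⟨min (min ε₁ ε₂) ε₃, by positivity, N₁ ∩ Metric.closedBall z₀ r,
    inter_mem hN₁ (Metric.closedBall_mem_nhds z₀ hr'), fun z t => α (z, t), fun t => (Γ t).2,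
    fun z hz => ⟨(hα z hz.2).1, fun t ht => ⟨hαd z hz.2 t (hlt t ht).1,
      (hNI (mk_mem_prod hz.1 (h3 t (hlt t ht).2.2).2.2)).1⟩⟩, by simp [hΓ0],
    fun T hT => ⟨hDd T hT, ?_⟩⟩
  have hO : (fun z => α (z, T) - α (z₀, T) - (Γ T).2 (z - z₀)) =O[𝓝 z₀]
      fun z => ‖z - z₀‖ ^ 2 := by
    refine Asymptotics.IsBigO.of_bound (C * 4 * gronwallBound 0 K 1 |T|) ?_
    -- Radius `ρ / 4`: with `‖D‖ ≤ 2` the correction `D (z - z₀)` stays below `ρ / 2`, and `α (z₀,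
    -- t)` is within `ρ / 2` of `z₀`, so the linearised curve stays in the ball of radius `ρ`.
    filter_upwards [hN₁, Metric.closedBall_mem_nhds z₀ hr',
      Metric.ball_mem_nhds z₀ (show 0 < ρ / 4 by positivity)] with z hzN hzr hzρ
    have hball : ∀ z ∈ N₁, ∀ t ∈ Ioo (-min (min ε₁ ε₂) ε₃) (min (min ε₁ ε₂) ε₃),
        α (z, t) ∈ Metric.ball z₀ (ρ / 2) := fun z hz t ht =>
      (hNI (mk_mem_prod hz (h3 t (hlt t ht).2.2).2.2)).2
    have hsub : Metric.ball z₀ (ρ / 2) ⊆ Metric.ball z₀ ρ := Metric.ball_subset_ball (by linarith)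
    have := norm_sub_linearization_le_abs (W' := fderiv ℝ W) hK hC (γ := fun t => α (z₀, t))
      (α := fun t => α (z, t)) (D := fun t => (Γ t).2) (h := z - z₀)
      (fun t ht => hαd z₀ hz₀r t (hlt t ht).1) (fun t ht => hαd z hzr t (hlt t ht).1) hDd
      (fun t ht => hsub (hball z₀ (mem_of_mem_nhds hN₁) t ht)) (fun t ht => hsub (hball z hzN t ht))
      (fun t ht => by
        have h4 := hball z₀ (mem_of_mem_nhds hN₁) t ht
        rw [mem_ball_iff_norm] at h4 hzρ ⊢
        have h5 := (Γ t).2.le_of_opNorm_le (h3 t (hlt t ht).2.2).2.1.le (z - z₀)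
        calc ‖α (z₀, t) + (Γ t).2 (z - z₀) - z₀‖
            = ‖(α (z₀, t) - z₀) + (Γ t).2 (z - z₀)‖ := by congr 1; abel
          _ ≤ ‖α (z₀, t) - z₀‖ + ‖(Γ t).2 (z - z₀)‖ := norm_add_le _ _
          _ < ρ := by linarith)
      (fun t ht => (h3 t (hlt t ht).2.2).2.1.le)
      (by simp [hΓ0, hα0, (hα z hzr).1]) hT
    rw [gronwallBound_zero_left] at this
    refine this.trans (le_of_eq ?_)
    rw [Real.norm_of_nonneg (by positivity)]
    ring
  have h6 := (hO.hasFDerivAt one_lt_two).add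
    (((Γ T).2.hasFDerivAt (x := z₀)).add_const (α (z₀, T) - (Γ T).2 z₀))
  refine (h6.congr_fderiv (zero_add _)).congr_of_eventuallyEq (Eventually.of_forall fun z => ?_)
  simp only [Pi.add_apply, map_sub]
  abel

end LocalFlow

/-! ### First and second derivatives of determinants. -/

section Determinant

variable {m : Type*} [Fintype m] [DecidableEq m]

/-- Jacobi's formula for the derivative of a determinant. -/
theorem hasDerivAt_det {G : ℝ → Matrix m m ℝ} {G' : Matrix m m ℝ} {t : ℝ}
    (h : ∀ i j, HasDerivAt (fun t => G t i j) (G' i j) t) :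
    HasDerivAt (fun t => (G t).det) ((G t).adjugate * G').trace t := by
  simp only [Matrix.det_apply]
  have hprod : ∀ σ : Equiv.Perm m, HasDerivAt (fun t => Equiv.Perm.sign σ • ∏ i, G t (σ i) i)
      (Equiv.Perm.sign σ • ∑ i, (∏ j ∈ Finset.univ.erase i, G t (σ j) j) • G' (σ i) i) t :=
    fun σ => (HasDerivAt.fun_finsetProd fun i _ => h (σ i) i).const_smul _
  refine (HasDerivAt.fun_sum fun σ _ => hprod σ).congr_deriv ?_
  -- Cramer's rule: this diagonal entry is the determinant with one column differentiated, as in the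
  -- product rule.
  have hcol : ∀ i, ((G t).adjugate * G') i i = ((G t).updateCol i fun j => G' j i).det := by
    intro i
    rw [← Matrix.cramer_apply, Matrix.cramer_eq_adjugate_mulVec]
    rfl
  simp only [Matrix.trace, Matrix.diag_apply, hcol, Matrix.det_apply, Finset.smul_sum]
  rw [Finset.sum_comm]
  refine Finset.sum_congr rfl fun i _ => Finset.sum_congr rfl fun σ _ => ?_
  congr 1
  rw [← Finset.mul_prod_erase _ _ (Finset.mem_univ i), smul_eq_mul, mul_comm]
  congr 1
  · simp
  · refine Finset.prod_congr rfl fun j hj => ?_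
    rw [Matrix.updateCol_ne (Finset.ne_of_mem_erase hj)]

/-- Differentiate adj(G) G = det(G) 1 where G = 1: this gives adj(G)' + G' = tr(G') 1. -/
theorem hasDerivAt_adjugate_of_eq_one {G : ℝ → Matrix m m ℝ} {G' : Matrix m m ℝ} {t : ℝ}
    (h : ∀ i j, HasDerivAt (fun t => G t i j) (G' i j) t) (h1 : G t = 1) (i j : m) :
    HasDerivAt (fun t => (G t).adjugate i j)
      ((G'.trace • (1 : Matrix m m ℝ) - G') i j) t := by
  have hdiff : ∀ i j, DifferentiableAt ℝ (fun t => (G t).adjugate i j) t := by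
    intro i j
    simp only [Matrix.adjugate_apply]
    refine (hasDerivAt_det (G := fun t => (G t).updateRow j (Pi.single i 1))
      (G' := G'.updateRow j 0) fun k l => ?_).differentiableAt
    by_cases hk : k = j
    · subst hk
      simpa using hasDerivAt_const t _
    · simpa [Matrix.updateRow_ne hk] using h k l
  have hmul : HasDerivAt (fun t => ∑ k, (G t).adjugate i k * G t k j)
      (∑ k, (deriv (fun t => (G t).adjugate i k) t * G t k j + (G t).adjugate i k * G' k j)) t :=
    HasDerivAt.fun_sum fun k _ => (hdiff i k).hasDerivAt.mul (h k j)
  have hdet : HasDerivAt (fun t => ∑ k, (G t).adjugate i k * G t k j)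
      (((G t).adjugate * G').trace * (1 : Matrix m m ℝ) i j) t := by
    have : (fun t => ∑ k, (G t).adjugate i k * G t k j) =
        fun t => (G t).det * (1 : Matrix m m ℝ) i j := by
      ext t
      rw [← Matrix.mul_apply, Matrix.adjugate_mul, Matrix.smul_apply, smul_eq_mul]
    rw [this]
    exact (hasDerivAt_det h).mul_const _
  have key := hmul.unique hdet
  rw [Finset.sum_add_distrib, h1, Matrix.adjugate_one, Matrix.one_mul] at key
  simp only [Matrix.one_apply, mul_ite, mul_one, mul_zero, ite_mul, one_mul, zero_mul,
    Finset.sum_ite_eq', Finset.sum_ite_eq, Finset.mem_univ, if_true] at key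
  refine (hdiff i j).hasDerivAt.congr_deriv ?_
  simp only [Matrix.sub_apply, Matrix.smul_apply, Matrix.one_apply, smul_eq_mul, mul_ite, mul_one,
    mul_zero]
  linarith

/-- The second derivative of `√det G` where `G = 1`. -/
theorem iteratedDeriv_two_sqrt_det {G G' : ℝ → Matrix m m ℝ} {G'' : Matrix m m ℝ} {t₀ : ℝ}
    (hG : ∀ᶠ t in 𝓝 t₀, ∀ i j, HasDerivAt (fun t => G t i j) (G' t i j) t)
    (hG' : ∀ i j, HasDerivAt (fun t => G' t i j) (G'' i j) t₀) (h1 : G t₀ = 1) :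
    iteratedDeriv 2 (fun t => √(G t).det) t₀ =
      (G''.trace - (G' t₀ * G' t₀).trace) / 2 + (G' t₀).trace ^ 2 / 4 := by
  have hG0 := hG.self_of_nhds
  have hdet := hasDerivAt_det hG0
  have hpos : ∀ᶠ t in 𝓝 t₀, 0 < (G t).det :=
    continuousAt_const.eventually_lt hdet.continuousAt (by simp [h1])
  have hderiv : deriv (fun t => √(G t).det) =ᶠ[𝓝 t₀]
      fun t => ((G t).adjugate * G' t).trace / (2 * √(G t).det) := by
    filter_upwards [hG, hpos] with t ht htpos
    exact ((hasDerivAt_det ht).sqrt htpos.ne').deriv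
  have hnum : HasDerivAt (fun t => ((G t).adjugate * G' t).trace)
      (((G' t₀).trace • (1 : Matrix m m ℝ) - G' t₀) * G' t₀ + G'').trace t₀ := by
    simp only [Matrix.trace, Matrix.diag_apply, Matrix.mul_apply, Matrix.add_apply]
    refine HasDerivAt.fun_sum fun i _ => ?_
    refine (HasDerivAt.fun_sum (u := Finset.univ) fun k _ =>
      (hasDerivAt_adjugate_of_eq_one hG0 h1 i k).mul (hG' k i)).congr_deriv ?_
    rw [Finset.sum_add_distrib, h1, Matrix.adjugate_one]
    simp [Matrix.one_apply, Matrix.trace]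
  have hden := (hdet.sqrt (by simp [h1])).const_mul 2
  rw [iteratedDeriv_succ, iteratedDeriv_one, hderiv.deriv_eq,
    (hnum.fun_div hden (by simp [h1])).deriv]
  simp only [h1, Matrix.adjugate_one, Matrix.det_one, Real.sqrt_one, Matrix.one_mul,
    Matrix.trace_add, Matrix.trace_sub, Matrix.sub_mul, Matrix.smul_mul, Matrix.trace_smul,
    smul_eq_mul]
  ring

end Determinant

/-! ### Linear algebra of the projection and its derivatives; traces over V. -/

section Algebra

variable {V : Type*} [NormedAddCommGroup V] [InnerProductSpace ℝ V]
  {E : Type*} [NormedAddCommGroup E] [NormedSpace ℝ E]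

/-- The algebraic relations between the derivatives at a point of an immersion with differential
`A` and second derivative `B`, the left inverse `L` of `A` and its derivative `L₁`, and the
projection `P = A L` and its derivatives `P₁`, `P₂`. -/
structure IsProjectionJet (A : E →L[ℝ] V) (B : E →L[ℝ] E →L[ℝ] V) (L : V →L[ℝ] E)
    (L₁ : E →L[ℝ] V →L[ℝ] E) (P : V →L[ℝ] V) (P₁ : E →L[ℝ] V →L[ℝ] V)
    (P₂ : E →L[ℝ] E →L[ℝ] V →L[ℝ] V) : Prop where
  second_symm : ∀ X Y, B X Y = B Y X
  inner_proj : ∀ v w, ⟪P v, w⟫_ℝ = ⟪v, P w⟫_ℝ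
  inner_proj₁ : ∀ X v w, ⟪P₁ X v, w⟫_ℝ = ⟪v, P₁ X w⟫_ℝ
  inner_proj₂ : ∀ X Y v w, ⟪P₂ X Y v, w⟫_ℝ = ⟪v, P₂ X Y w⟫_ℝ
  left_inv : ∀ X, L (A X) = X
  comp : ∀ v, A (L v) = P v
  comp₁ : ∀ X v, B X (L v) + A (L₁ X v) = P₁ X v
  proj_tangent : ∀ X, P (A X) = A X
  proj_tangent₁ : ∀ X Y, P₁ X (A Y) + P (B X Y) = B X Y
  idem₁ : ∀ X v, P₁ X (P v) + P (P₁ X v) = P₁ X v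
  idem₂ : ∀ X Y v,
    P₂ X Y (P v) + P₁ Y (P₁ X v) + (P₁ X (P₁ Y v) + P (P₂ X Y v)) = P₂ X Y v

namespace IsProjectionJet

variable {A : E →L[ℝ] V} {B : E →L[ℝ] E →L[ℝ] V} {L : V →L[ℝ] E}
  {L₁ : E →L[ℝ] V →L[ℝ] E} {P : V →L[ℝ] V} {P₁ : E →L[ℝ] V →L[ℝ] V}
  {P₂ : E →L[ℝ] E →L[ℝ] V →L[ℝ] V}
  {κ : Type*} [Fintype κ] {g : κ → E} {ι : Type*} [Fintype ι] (b : OrthonormalBasis ι ℝ V)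

/-- `P₁ X (A Y)` is the normal part of `B X Y`, that is, the second fundamental form; it inherits
the symmetry of `B`. -/
theorem form_symm (H : IsProjectionJet A B L L₁ P P₁ P₂) (X Y : E) : P₁ X (A Y) = P₁ Y (A X) := by
  have h1 := H.proj_tangent₁ X Y
  have h2 := H.proj_tangent₁ Y X
  rw [H.second_symm Y X] at h2
  exact add_right_cancel (h1.trans h2.symm)

theorem proj_form (H : IsProjectionJet A B L L₁ P P₁ P₂) (X Y : E) : P (P₁ X (A Y)) = 0 := by
  have h := H.idem₁ X (A Y)
  rwa [H.proj_tangent, add_eq_left] at h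

theorem inner_tangent_form (H : IsProjectionJet A B L L₁ P P₁ P₂) (X Y Z : E) : ⟪A Z, P₁ X (A Y)⟫_ℝ = 0 := by
  rw [← H.proj_tangent, H.inner_proj, H.proj_form, inner_zero_right]

theorem left_inv_eq_sum (H : IsProjectionJet A B L L₁ P P₁ P₂)
    (hg : Orthonormal ℝ fun a => A (g a))
    (hspan : Submodule.span ℝ (range g) = ⊤) (v : V) :
    L v = ∑ a, ⟪A (g a), v⟫_ℝ • g a := by
  obtain ⟨c, hc⟩ := (Submodule.mem_span_range_iff_exists_fun ℝ).mp
    (hspan ▸ Submodule.mem_top : L v ∈ Submodule.span ℝ (range g))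
  rw [← hc]
  refine Finset.sum_congr rfl fun a _ => ?_
  congr 1
  rw [← H.proj_tangent, H.inner_proj, ← H.comp, ← hc, map_sum]
  simp only [map_smul]
  exact (hg.inner_right_fintype c a).symm

theorem proj_eq_sum (H : IsProjectionJet A B L L₁ P P₁ P₂)
    (hg : Orthonormal ℝ fun a => A (g a))
    (hspan : Submodule.span ℝ (range g) = ⊤) (v : V) :
    P v = ∑ a, ⟪A (g a), v⟫_ℝ • A (g a) := by
  rw [← H.comp, H.left_inv_eq_sum hg hspan, map_sum]
  simp only [map_smul]

/-- Expanding `L (b i)` in the frame `g` turns the sum into the inner products of `A (g a)` with `P₂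
(g a) X (A X)`. Pairing the twice differentiated P² = P with `A (g a)` doubles this `P₂` term on one
side, so it equals minus the two products of first derivatives. -/
theorem sum_inner_second (H : IsProjectionJet A B L L₁ P P₁ P₂)
    (hg : Orthonormal ℝ fun a => A (g a))
    (hspan : Submodule.span ℝ (range g) = ⊤) (X : E) :
    ∑ i, ⟪P₂ (L (b i)) X (b i), A X⟫_ℝ =
      ∑ a, (-⟪P₁ X (A X), P₁ (g a) (A (g a))⟫_ℝ - ‖P₁ X (A (g a))‖ ^ 2) := by
  have h1 : ∀ i, ⟪P₂ (L (b i)) X (b i), A X⟫_ℝ =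
      ∑ a, ⟪A (g a), b i⟫_ℝ * ⟪b i, P₂ (g a) X (A X)⟫_ℝ := by
    intro i
    rw [H.inner_proj₂, H.left_inv_eq_sum hg hspan]
    simp [inner_sum, inner_smul_right]
  simp only [h1]
  rw [Finset.sum_comm]
  refine Finset.sum_congr rfl fun a _ => ?_
  rw [b.sum_inner_mul_inner]
  have h2 := congrArg (fun w => ⟪A (g a), w⟫_ℝ) (H.idem₂ (g a) X (A X))
  simp only [H.proj_tangent, inner_add_right] at h2
  rw [← H.inner_proj (A (g a)), H.proj_tangent, ← H.inner_proj₁ X (A (g a)),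
    ← H.inner_proj₁ (g a) (A (g a)), H.form_symm (g a) X, real_inner_self_eq_norm_sq,
    real_inner_comm (P₁ X (A X))] at h2
  linarith

/-- By `comp₁`, `L₁ X (b i)` has frame coefficients coming from `P₁ X (b i)` and from `B X (L (b
i))`. After summation the second contribution pairs a tangent vector with a value of the second
fundamental form and vanishes. -/
theorem sum_inner_first (H : IsProjectionJet A B L L₁ P P₁ P₂)
    (hg : Orthonormal ℝ fun a => A (g a))
    (hspan : Submodule.span ℝ (range g) = ⊤) (X : E) :
    ∑ i, ⟪P₁ (L₁ X (b i)) (b i), A X⟫_ℝ = ∑ a, ‖P₁ X (A (g a))‖ ^ 2 := by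
  have h1 : ∀ i, ⟪P₁ (L₁ X (b i)) (b i), A X⟫_ℝ =
      ∑ a, (⟪P₁ X (A (g a)), b i⟫_ℝ * ⟪b i, P₁ X (A (g a))⟫_ℝ -
        ∑ c, ⟪A (g c), b i⟫_ℝ * ⟪b i, P₁ X (A (g a))⟫_ℝ * ⟪A (g a), B X (g c)⟫_ℝ) := by
    intro i
    have h2 : L₁ X (b i) = ∑ a, (⟪P₁ X (A (g a)), b i⟫_ℝ -
        ∑ c, ⟪A (g c), b i⟫_ℝ * ⟪A (g a), B X (g c)⟫_ℝ) • g a := by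
      rw [← H.left_inv (L₁ X (b i)), H.left_inv_eq_sum hg hspan,
        eq_sub_of_add_eq' (H.comp₁ X (b i))]
      refine Finset.sum_congr rfl fun a _ => ?_
      rw [inner_sub_right, H.inner_proj₁, H.left_inv_eq_sum hg hspan]
      simp [inner_sum, inner_smul_right]
    rw [H.inner_proj₁, h2]
    simp only [map_sum, map_smul, sum_apply, smul_apply, inner_sum,
      inner_smul_right, sub_mul, Finset.sum_mul, H.form_symm (g _) X]
    refine Finset.sum_congr rfl fun a _ => ?_
    congr 1
    exact Finset.sum_congr rfl fun c _ => by ring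
  simp only [h1]
  rw [Finset.sum_comm]
  refine Finset.sum_congr rfl fun a _ => ?_
  rw [Finset.sum_sub_distrib, b.sum_inner_mul_inner, real_inner_self_eq_norm_sq, sub_eq_self,
    Finset.sum_comm]
  refine Finset.sum_eq_zero fun c _ => ?_
  rw [← Finset.sum_mul, b.sum_inner_mul_inner, H.inner_tangent_form, zero_mul]

/-- `P₁ X` is symmetric and exchanges tangent and normal vectors, so its two off-diagonal blocks
contribute equally; hence the factor 2. -/
theorem sum_norm_sq_first (H : IsProjectionJet A B L L₁ P P₁ P₂)
    (hg : Orthonormal ℝ fun a => A (g a))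
    (hspan : Submodule.span ℝ (range g) = ⊤) (X : E) :
    ∑ i, ‖P₁ X (b i)‖ ^ 2 = ∑ a, 2 * ‖P₁ X (A (g a))‖ ^ 2 := by
  have h1 : ∀ i, ‖P₁ X (b i)‖ ^ 2 =
      ∑ a, (⟪A (g a), b i⟫_ℝ * ⟪b i, P₁ X (P₁ X (A (g a)))⟫_ℝ +
        ⟪P₁ X (A (g a)), b i⟫_ℝ * ⟪b i, P₁ X (A (g a))⟫_ℝ) := by
    intro i
    rw [← real_inner_self_eq_norm_sq]
    nth_rw 2 [← H.idem₁ X (b i)]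
    rw [inner_add_right, H.proj_eq_sum hg hspan (b i), H.proj_eq_sum hg hspan (P₁ X (b i)),
      Finset.sum_add_distrib]
    simp only [map_sum, map_smul, inner_sum, inner_smul_right, H.inner_proj₁]
  simp only [h1]
  rw [Finset.sum_comm]
  refine Finset.sum_congr rfl fun a _ => ?_
  rw [Finset.sum_add_distrib, b.sum_inner_mul_inner, b.sum_inner_mul_inner, ← H.inner_proj₁,
    real_inner_self_eq_norm_sq]
  ring

/-- The trace over `V` of the second variation of the volume of the frame `e`. -/
theorem sum_secondVariation (H : IsProjectionJet A B L L₁ P P₁ P₂)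
    {p q : ℕ} {e : Fin p → E} {n : Fin q → E}
    (hg : Orthonormal ℝ fun a : Fin p ⊕ Fin q => A (Sum.elim e n a))
    (hspan : Submodule.span ℝ (range (Sum.elim e n)) = ⊤) :
    ∑ i, ((∑ j, (⟪P₂ (L (b i)) (e j) (b i), A (e j)⟫_ℝ + ⟪P₁ (L₁ (e j) (b i)) (b i), A (e j)⟫_ℝ +
        ‖P₁ (e j) (b i)‖ ^ 2)) - 2 * ∑ j, ∑ k, ⟪b i, P₁ (e j) (A (e k))⟫_ℝ ^ 2 +
        (∑ j, ⟪b i, P₁ (e j) (A (e j))⟫_ℝ) ^ 2) =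
      ∑ j, ∑ k, (2 * ‖P₁ (e j) (A (n k))‖ ^ 2 -
        ⟪P₁ (e j) (A (e j)), P₁ (n k) (A (n k))⟫_ℝ) := by
  have hsq : ∀ v w : V, ∑ i, ⟪b i, v⟫_ℝ * ⟪b i, w⟫_ℝ = ⟪v, w⟫_ℝ := fun v w => by
    rw [← b.sum_inner_mul_inner]
    simp only [real_inner_comm v]
  have h1 : ∑ i, ∑ j, ∑ k, ⟪b i, P₁ (e j) (A (e k))⟫_ℝ ^ 2 =
      ∑ j, ∑ k, ‖P₁ (e j) (A (e k))‖ ^ 2 := by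
    rw [Finset.sum_comm]
    refine Finset.sum_congr rfl fun j _ => ?_
    rw [Finset.sum_comm]
    refine Finset.sum_congr rfl fun k _ => ?_
    simp only [pow_two ⟪_, _⟫_ℝ, hsq, real_inner_self_eq_norm_sq]
  have h2 : ∑ i, (∑ j, ⟪b i, P₁ (e j) (A (e j))⟫_ℝ) ^ 2 =
      ∑ j, ∑ k, ⟪P₁ (e j) (A (e j)), P₁ (e k) (A (e k))⟫_ℝ := by
    simp only [pow_two, Finset.sum_mul_sum]
    rw [Finset.sum_comm]
    refine Finset.sum_congr rfl fun j _ => ?_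
    rw [Finset.sum_comm]
    exact Finset.sum_congr rfl fun k _ => hsq _ _
  rw [Finset.sum_add_distrib, Finset.sum_sub_distrib, ← Finset.mul_sum, h1, h2, Finset.sum_comm,
    Finset.mul_sum, ← Finset.sum_sub_distrib, ← Finset.sum_add_distrib]
  refine Finset.sum_congr rfl fun j _ => ?_
  rw [Finset.sum_add_distrib, Finset.sum_add_distrib, H.sum_inner_second b hg hspan,
    H.sum_inner_first b hg hspan, H.sum_norm_sq_first b hg hspan]
  -- Splitting the basis of the tangent space into `e` and `n`: the `e` block cancels the two
  -- quadratic terms.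
  simp only [Fintype.sum_sum_type, Sum.elim_inl, Sum.elim_inr, Finset.sum_sub_distrib,
    Finset.sum_neg_distrib, ← Finset.mul_sum]
  ring

end IsProjectionJet

end Algebra

/-! ### An explicit left inverse that depends smoothly on the injective map. -/

section LeftInverse

variable {V : Type*} [NormedAddCommGroup V] [InnerProductSpace ℝ V]
  {E : Type*} [NormedAddCommGroup E] [NormedSpace ℝ E]

/-- The transpose of `A`, where `V` is identified with its dual. -/
def transpose (A : E →L[ℝ] V) : V →L[ℝ] (E →L[ℝ] ℝ) :=
  ((ContinuousLinearMap.compL ℝ E V ℝ).flip A) ∘L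
    (isBoundedBilinearMap_inner (𝕜 := ℝ) (E := V)).toContinuousLinearMap

theorem transpose_apply (A : E →L[ℝ] V) (v : V) (X : E) : transpose A v X = ⟪v, A X⟫_ℝ := rfl

/-- The left inverse `(Aᵀ A)⁻¹ Aᵀ` of an injective linear map. -/
def leftInverse (A : E →L[ℝ] V) : V →L[ℝ] E :=
  (transpose A ∘L A).inverse ∘L transpose A

variable [FiniteDimensional ℝ E]

/-- If AᵀAX = 0, evaluating at X gives ‖AX‖² = 0, so AᵀA is injective; its source and target have
equal finite dimension. -/
theorem exists_equiv_transpose_comp {A : E →L[ℝ] V} (hA : Function.Injective A) :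
    ∃ e : E ≃L[ℝ] (E →L[ℝ] ℝ), (e : E →L[ℝ] (E →L[ℝ] ℝ)) = transpose A ∘L A := by
  have hinj : Function.Injective (transpose A ∘L A : E →L[ℝ] (E →L[ℝ] ℝ)) := by
    refine (injective_iff_map_eq_zero _).mpr fun X hX => ?_
    have h : transpose A (A X) X = 0 := by
      rw [← ContinuousLinearMap.comp_apply, hX, zero_apply]
    rw [transpose_apply, inner_self_eq_zero] at h
    exact hA (h.trans (map_zero A).symm)
  have hdim : Module.finrank ℝ E = Module.finrank ℝ (E →L[ℝ] ℝ) := by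
    rw [← Subspace.dual_finrank_eq (K := ℝ) (V := E)]
    exact LinearEquiv.finrank_eq (LinearMap.toContinuousLinearMap (𝕜 := ℝ) (E := E) (F' := ℝ))
  exact ⟨((transpose A ∘L A).toLinearMap.linearEquivOfInjective hinj hdim).toContinuousLinearEquiv,
    by ext; rfl⟩

theorem leftInverse_apply_apply {A : E →L[ℝ] V} (hA : Function.Injective A) (X : E) :
    leftInverse A (A X) = X := by
  obtain ⟨e, he⟩ := exists_equiv_transpose_comp hA
  have h : transpose A (A X) = e X := by
    rw [← ContinuousLinearMap.comp_apply, ← he]; rfl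
  rw [leftInverse, ContinuousLinearMap.comp_apply, h, ← he, ContinuousLinearMap.inverse_equiv]
  exact e.symm_apply_apply X

/-- Normal equations: Aᵀ(v - ALv) = 0 says that the residual is orthogonal to the range of A. -/
theorem apply_leftInverse {A : E →L[ℝ] V} (hA : Function.Injective A)
    [A.range.HasOrthogonalProjection] (v : V) :
    A (leftInverse A v) = A.range.starProjection v := by
  obtain ⟨e, he⟩ := exists_equiv_transpose_comp hA
  have h : transpose A (A (leftInverse A v)) = transpose A v := by
    rw [← ContinuousLinearMap.comp_apply (transpose A), leftInverse,
      ContinuousLinearMap.comp_apply _ (transpose A), ← he, ContinuousLinearMap.inverse_equiv]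
    exact e.apply_symm_apply _
  refine (Submodule.eq_starProjection_of_mem_of_inner_eq_zero
    (LinearMap.mem_range_self A.toLinearMap _) ?_).symm
  rintro _ ⟨X, rfl⟩
  have := congrArg (fun ℓ : E →L[ℝ] ℝ => ℓ X) h
  simp only [transpose_apply] at this
  rw [inner_sub_left, sub_eq_zero]
  exact this.symm

theorem contDiffAt_leftInverse {A : E →L[ℝ] V} (hA : Function.Injective A) :
    ContDiffAt ℝ ∞ leftInverse A := by
  have hT : ContDiff ℝ ∞ (transpose : (E →L[ℝ] V) → _) :=
    (ContinuousLinearMap.contDiff (ContinuousLinearMap.compL ℝ E V ℝ).flip).clm_comp contDiff_const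
  obtain ⟨e, he⟩ := exists_equiv_transpose_comp hA
  have hinv : ContDiffAt ℝ ∞ ContinuousLinearMap.inverse (transpose A ∘L A) := by
    rw [← he]
    exact contDiffAt_map_inverse e
  exact (ContDiffAt.comp A (f := fun A => transpose A ∘L A) hinv
    (hT.contDiffAt.clm_comp contDiffAt_id)).clm_comp hT.contDiffAt

end LeftInverse

/-! ### The tangent projection of an immersion and its differentiated identities. -/

section Jet

variable {V : Type*} [NormedAddCommGroup V] [InnerProductSpace ℝ V]
  {E : Type*} [NormedAddCommGroup E] [NormedSpace ℝ E]

theorem inner_fderiv_symm {Q : E → V →L[ℝ] V} {z₀ : E} (hQ : DifferentiableAt ℝ Q z₀)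
    (h : ∀ᶠ z in 𝓝 z₀, ∀ v w, ⟪Q z v, w⟫_ℝ = ⟪v, Q z w⟫_ℝ) (X : E) (v w : V) :
    ⟪fderiv ℝ Q z₀ X v, w⟫_ℝ = ⟪v, fderiv ℝ Q z₀ X w⟫_ℝ := by
  have hd : ∀ v : V, HasFDerivAt (fun z => Q z v) ((fderiv ℝ Q z₀).flip v) z₀ := fun v =>
    (hQ.hasFDerivAt.clm_apply (hasFDerivAt_const v z₀)).congr_fderiv (by ext; simp)
  have h1 := (hd v).inner ℝ (hasFDerivAt_const w z₀)
  have h2 := (hasFDerivAt_const v z₀).inner ℝ (hd w)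
  have := congrArg (fun ℓ : E →L[ℝ] ℝ => ℓ X)
    (h1.unique (h2.congr_of_eventuallyEq (h.mono fun z hz => hz v w)))
  simpa using this

theorem fderiv_clm_comp_apply {G H K : Type*} [NormedAddCommGroup G] [NormedSpace ℝ G]
    [NormedAddCommGroup H] [NormedSpace ℝ H] [NormedAddCommGroup K] [NormedSpace ℝ K]
    {Q : E → H →L[ℝ] K} {R : E → G →L[ℝ] H} {S : E → G →L[ℝ] K} {z₀ : E}
    (hQ : DifferentiableAt ℝ Q z₀) (hR : DifferentiableAt ℝ R z₀)
    (h : ∀ᶠ z in 𝓝 z₀, ∀ v, Q z (R z v) = S z v) (X : E) (v : G) :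
    fderiv ℝ Q z₀ X (R z₀ v) + Q z₀ (fderiv ℝ R z₀ X v) = fderiv ℝ S z₀ X v := by
  have hS : S =ᶠ[𝓝 z₀] fun z => Q z ∘L R z :=
    h.mono fun z hz => ContinuousLinearMap.ext fun v => (hz v).symm
  rw [hS.fderiv_eq, fderiv_clm_comp hQ hR]
  simp [add_comm]

variable [FiniteDimensional ℝ E]

/-- The orthogonal projection onto the image of the differential of `F`. -/
def tangentProjection (F : E → V) (z : E) : V →L[ℝ] V :=
  fderiv ℝ F z ∘L leftInverse (fderiv ℝ F z)

theorem tangentProjection_eq {F : E → V} {z : E} (h : Function.Injective (fderiv ℝ F z)) (v : V) :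
    tangentProjection F z v = (fderiv ℝ F z).range.starProjection v :=
  apply_leftInverse h v

theorem contDiffAt_leftInverse_fderiv {F : E → V} {z₀ : E} (hF : ContDiffAt ℝ ∞ F z₀)
    (hinj : Function.Injective (fderiv ℝ F z₀)) :
    ContDiffAt ℝ ∞ (fun z => leftInverse (fderiv ℝ F z)) z₀ :=
  (contDiffAt_leftInverse hinj).comp z₀ (hF.fderiv_right (by simp))

theorem contDiffAt_tangentProjection {F : E → V} {z₀ : E} (hF : ContDiffAt ℝ ∞ F z₀)
    (hinj : Function.Injective (fderiv ℝ F z₀)) : ContDiffAt ℝ ∞ (tangentProjection F) z₀ :=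
  ContDiffAt.clm_comp (hF.fderiv_right (by simp)) (contDiffAt_leftInverse_fderiv hF hinj)

/-- The pointwise identities for P, A and L hold on a whole neighbourhood and may be differentiated
there. Symmetry and idempotence of P are differentiated twice, the second time with the inner
direction `Y` held fixed. -/
theorem isProjectionJet {F : E → V} {z₀ : E} (hF : ContDiffAt ℝ ∞ F z₀)
    (hinj : ∀ᶠ z in 𝓝 z₀, Function.Injective (fderiv ℝ F z)) :
    IsProjectionJet (fderiv ℝ F z₀) (fderiv ℝ (fderiv ℝ F) z₀) (leftInverse (fderiv ℝ F z₀))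
      (fderiv ℝ (fun z => leftInverse (fderiv ℝ F z)) z₀) (tangentProjection F z₀)
      (fderiv ℝ (tangentProjection F) z₀)
      (fderiv ℝ (fderiv ℝ (tangentProjection F)) z₀) := by
  have hinj0 := hinj.self_of_nhds
  have hA : DifferentiableAt ℝ (fderiv ℝ F) z₀ :=
    (hF.fderiv_right (m := ∞) (by simp)).differentiableAt (by simp)
  have hL := (contDiffAt_leftInverse_fderiv hF hinj0).differentiableAt (by simp)
  have hPs := contDiffAt_tangentProjection hF hinj0
  have hP : DifferentiableAt ℝ (tangentProjection F) z₀ := hPs.differentiableAt (by simp)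
  have hP1 : DifferentiableAt ℝ (fderiv ℝ (tangentProjection F)) z₀ :=
    (hPs.fderiv_right (m := ∞) (by simp)).differentiableAt (by simp)
  have hPd : ∀ᶠ z in 𝓝 z₀, DifferentiableAt ℝ (tangentProjection F) z := by
    filter_upwards [(hPs.of_le ENat.LEInfty.out : ContDiffAt ℝ 1 _ _).eventually (by simp)]
      with z hz using hz.differentiableAt (by simp)
  have hdir : ∀ X Y, fderiv ℝ (fun z => fderiv ℝ (tangentProjection F) z Y) z₀ X =
      fderiv ℝ (fderiv ℝ (tangentProjection F)) z₀ X Y := fun X Y => by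
    rw [fderiv_clm_apply hP1 (differentiableAt_const Y)]
    simp
  have hdirD : ∀ Y, DifferentiableAt ℝ (fun z => fderiv ℝ (tangentProjection F) z Y) z₀ :=
    fun Y => hP1.clm_apply (differentiableAt_const Y)
  have hsymm : ∀ᶠ z in 𝓝 z₀, ∀ v w,
      ⟪tangentProjection F z v, w⟫_ℝ = ⟪v, tangentProjection F z w⟫_ℝ := by
    filter_upwards [hinj] with z hz v w
    rw [tangentProjection_eq hz, tangentProjection_eq hz,
      Submodule.inner_starProjection_left_eq_right]
  have hidem : ∀ᶠ z in 𝓝 z₀, ∀ v,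
      tangentProjection F z (tangentProjection F z v) = tangentProjection F z v := by
    filter_upwards [hinj] with z hz v
    exact congrArg (fderiv ℝ F z) (leftInverse_apply_apply hz _)
  have htan : ∀ᶠ z in 𝓝 z₀, ∀ X, tangentProjection F z (fderiv ℝ F z X) = fderiv ℝ F z X := by
    filter_upwards [hinj] with z hz X
    exact congrArg (fderiv ℝ F z) (leftInverse_apply_apply hz X)
  have hidem1 : ∀ᶠ z in 𝓝 z₀, ∀ Y v, fderiv ℝ (tangentProjection F) z Y (tangentProjection F z v) +
      tangentProjection F z (fderiv ℝ (tangentProjection F) z Y v) =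
      fderiv ℝ (tangentProjection F) z Y v := by
    filter_upwards [hidem.eventually_nhds, hPd] with z hz hd Y v
    exact fderiv_clm_comp_apply hd hd hz Y v
  refine ⟨fun X Y => ?_, hsymm.self_of_nhds, inner_fderiv_symm hP hsymm, fun X Y v w => ?_,
    leftInverse_apply_apply hinj0, fun v => rfl,
    fderiv_clm_comp_apply hA hL (Eventually.of_forall fun z v => rfl), htan.self_of_nhds,
    fderiv_clm_comp_apply hP hA htan, hidem1.self_of_nhds, fun X Y v => ?_⟩
  · exact (hF.isSymmSndFDerivAt (by simpa using ENat.LEInfty.out)).eq X Y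
  · rw [← hdir]
    refine inner_fderiv_symm (hdirD Y) ?_ X v w
    filter_upwards [hsymm.eventually_nhds, hPd] with z hz hd
    exact inner_fderiv_symm hd hz Y
  · have h1 := fderiv_clm_comp_apply (hdirD Y) hP
      (S := fun z => fderiv ℝ (tangentProjection F) z Y ∘L tangentProjection F z)
      (Eventually.of_forall fun z v => rfl) X v
    have h2 := fderiv_clm_comp_apply hP (hdirD Y)
      (S := fun z => tangentProjection F z ∘L fderiv ℝ (tangentProjection F) z Y)
      (Eventually.of_forall fun z v => rfl) X v
    have h3 : (fun z => fderiv ℝ (tangentProjection F) z Y) =ᶠ[𝓝 z₀]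
        fun z => fderiv ℝ (tangentProjection F) z Y ∘L tangentProjection F z +
          tangentProjection F z ∘L fderiv ℝ (tangentProjection F) z Y :=
      hidem1.mono fun z hz => ContinuousLinearMap.ext fun v => (hz Y v).symm
    have h4 := h3.fderiv_eq (𝕜 := ℝ)
    rw [fderiv_fun_add ((hdirD Y).clm_comp hP) (hP.clm_comp (hdirD Y))] at h4
    have h5 := congrArg (fun ℓ : E →L[ℝ] V →L[ℝ] V => ℓ X v) h4
    simp only [hdir, add_apply] at h1 h2 h5
    exact (congrArg₂ (· + ·) h1 h2).trans h5.symm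

end Jet

/-! ### The second variation in a chart. -/

section LocalSecondVariation

variable {V : Type*} [NormedAddCommGroup V] [InnerProductSpace ℝ V]
  {E : Type*} [NormedAddCommGroup E] [NormedSpace ℝ E]

/-- The second variation of the volume of a frame that is orthonormal at time `t₀` and moves, to
first order, by a symmetric map. -/
theorem iteratedDeriv_two_sqrt_det_gram {p : ℕ} {w w' : Fin p → ℝ → V} {w'' : Fin p → V} {t₀ : ℝ}
    (hw : ∀ᶠ t in 𝓝 t₀, ∀ j, HasDerivAt (w j) (w' j t) t)
    (hw' : ∀ j, HasDerivAt (w' j) (w'' j) t₀) (horth : Orthonormal ℝ fun j => w j t₀)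
    (hsymm : ∀ i j, ⟪w i t₀, w' j t₀⟫_ℝ = ⟪w' i t₀, w j t₀⟫_ℝ) :
    iteratedDeriv 2 (fun t => √(Matrix.of fun i j => ⟪w i t, w j t⟫_ℝ).det) t₀ =
      (∑ j, (⟪w'' j, w j t₀⟫_ℝ + ‖w' j t₀‖ ^ 2)) - 2 * ∑ i, ∑ j, ⟪w' i t₀, w j t₀⟫_ℝ ^ 2 +
        (∑ j, ⟪w' j t₀, w j t₀⟫_ℝ) ^ 2 := by
  have hw0 := hw.self_of_nhds
  have hone : (Matrix.of fun i j => ⟪w i t₀, w j t₀⟫_ℝ) = 1 := by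
    ext i j
    simp [orthonormal_iff_ite.mp horth i j, Matrix.one_apply]
  rw [iteratedDeriv_two_sqrt_det (m := Fin p) (G := fun t => Matrix.of fun i j => ⟪w i t, w j t⟫_ℝ)
    (G' := fun t => Matrix.of fun i j => ⟪w i t, w' j t⟫_ℝ + ⟪w' i t, w j t⟫_ℝ)
    (G'' := Matrix.of fun i j => (⟪w i t₀, w'' j⟫_ℝ + ⟪w' i t₀, w' j t₀⟫_ℝ) +
      (⟪w' i t₀, w' j t₀⟫_ℝ + ⟪w'' i, w j t₀⟫_ℝ))
    (by filter_upwards [hw] with t ht i j using (ht i).inner ℝ (ht j))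
    (fun i j => ((hw0 i).inner ℝ (hw' j)).add ((hw' i).inner ℝ (hw0 j))) hone]
  have hsymm' : ∀ i j, ⟪w' j t₀, w i t₀⟫_ℝ = ⟪w' i t₀, w j t₀⟫_ℝ := fun i j => by
    rw [← hsymm i j, real_inner_comm]
  have h1 : ∀ i, ⟪w i t₀, w'' i⟫_ℝ + ⟪w' i t₀, w' i t₀⟫_ℝ +
      (⟪w' i t₀, w' i t₀⟫_ℝ + ⟪w'' i, w i t₀⟫_ℝ) =
      2 * (⟪w'' i, w i t₀⟫_ℝ + ‖w' i t₀‖ ^ 2) := fun i => by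
    rw [real_inner_comm, real_inner_self_eq_norm_sq]
    ring
  have h2 : ∀ i j, (⟪w' i t₀, w j t₀⟫_ℝ + ⟪w' i t₀, w j t₀⟫_ℝ) *
      (⟪w' j t₀, w i t₀⟫_ℝ + ⟪w' j t₀, w i t₀⟫_ℝ) = 4 * ⟪w' i t₀, w j t₀⟫_ℝ ^ 2 := fun i j => by
    rw [hsymm' i j]
    ring
  simp only [Matrix.trace, Matrix.diag_apply, Matrix.mul_apply, Matrix.of_apply, hsymm, h1, h2]
  simp only [← two_mul, ← Finset.mul_sum]
  ring

variable [FiniteDimensional ℝ E]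

/-- The vector field on `E` whose image under the differential of the immersion `F` is the
tangential part of `u`. -/
def localField (F : E → V) (u : V) (z : E) : E := leftInverse (fderiv ℝ F z) u

theorem contDiffAt_localField {F : E → V} {z₀ : E} (hF : ContDiffAt ℝ ∞ F z₀)
    (hinj : Function.Injective (fderiv ℝ F z₀)) (u : V) :
    ContDiffAt ℝ ∞ (localField F u) z₀ :=
  (contDiffAt_leftInverse_fderiv hF hinj).clm_apply contDiffAt_const

theorem fderiv_localField {F : E → V} {z₀ : E} (hF : ContDiffAt ℝ ∞ F z₀)
    (hinj : Function.Injective (fderiv ℝ F z₀)) (u : V) (X : E) :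
    fderiv ℝ (localField F u) z₀ X = fderiv ℝ (fun z => leftInverse (fderiv ℝ F z)) z₀ X u := by
  have hL := (contDiffAt_leftInverse_fderiv hF hinj).differentiableAt (by simp)
  have := (hL.hasFDerivAt.clm_apply (hasFDerivAt_const u z₀)).fderiv
  change fderiv ℝ (fun z => leftInverse (fderiv ℝ F z) u) z₀ X = _
  rw [this]
  simp

variable {F : E → V} {u : V} {γ : ℝ → E} {D : ℝ → E →L[ℝ] E}

/-- The product rule gives d²F(Lu, DX) + A(d(Lu)(DX)). Swapping the arguments of d²F makes this the
derivative of ALu = Pu in the direction DX. -/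
theorem hasDerivAt_pushforward {t : ℝ} (hF : ContDiffAt ℝ ∞ F (γ t))
    (hinj : ∀ᶠ z in 𝓝 (γ t), Function.Injective (fderiv ℝ F z))
    (hγ : HasDerivAt γ (localField F u (γ t)) t)
    (hD : HasDerivAt D (fderiv ℝ (localField F u) (γ t) ∘L D t) t) (X : E) :
    HasDerivAt (fun t => fderiv ℝ F (γ t) (D t X))
      (fderiv ℝ (tangentProjection F) (γ t) (D t X) u) t := by
  have H := isProjectionJet hF hinj
  have hA : DifferentiableAt ℝ (fderiv ℝ F) (γ t) :=
    (hF.fderiv_right (m := ∞) (by simp)).differentiableAt (by simp)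
  refine ((hA.hasFDerivAt.comp_hasDerivAt t hγ).clm_apply
    (hD.clm_apply (hasDerivAt_const t X))).congr_deriv ?_
  rw [← H.comp₁, H.second_symm (D t X), ← fderiv_localField hF hinj.self_of_nhds]
  simp [localField]

/-- The first term comes from the motion of the base point, the second from that of the transported
vector. -/
theorem hasDerivAt_fderiv_tangentProjection {t : ℝ} (hF : ContDiffAt ℝ ∞ F (γ t))
    (hinj : Function.Injective (fderiv ℝ F (γ t)))
    (hγ : HasDerivAt γ (localField F u (γ t)) t)
    (hD : HasDerivAt D (fderiv ℝ (localField F u) (γ t) ∘L D t) t) (X : E) :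
    HasDerivAt (fun t => fderiv ℝ (tangentProjection F) (γ t) (D t X) u)
      (fderiv ℝ (fderiv ℝ (tangentProjection F)) (γ t) (leftInverse (fderiv ℝ F (γ t)) u) (D t X) u +
        fderiv ℝ (tangentProjection F) (γ t)
          (fderiv ℝ (fun z => leftInverse (fderiv ℝ F z)) (γ t) (D t X) u) u) t := by
  have hP1 : DifferentiableAt ℝ (fderiv ℝ (tangentProjection F)) (γ t) :=
    ((contDiffAt_tangentProjection hF hinj).fderiv_right (m := ∞) (by simp)).differentiableAt
      (by simp)
  have hP2 := hP1.hasFDerivAt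
  have h1 : HasDerivAt (fun t => fderiv ℝ (tangentProjection F) (γ t))
      (fderiv ℝ (fderiv ℝ (tangentProjection F)) (γ t) (localField F u (γ t))) t :=
    HasFDerivAt.comp_hasDerivAt (l := fderiv ℝ (tangentProjection F)) t hP2 hγ
  have h2 : HasDerivAt (fun t => D t X) (fderiv ℝ (localField F u) (γ t) (D t X)) t :=
    (hD.clm_apply (hasDerivAt_const t X)).congr_deriv (by simp)
  have h3 := (h1.clm_apply h2).clm_apply (hasDerivAt_const t u)
  rw [map_zero, add_zero, add_apply, fderiv_localField hF hinj] at h3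
  exact h3

/-- The second variation, under the flow of the tangential part of `u`, of the volume of an
orthonormal frame `e` at the point `γ 0` of the immersed submanifold. -/
theorem iteratedDeriv_two_sqrt_det_pushforward (hF : ∀ᶠ z in 𝓝 (γ 0), ContDiffAt ℝ ∞ F z)
    (hinj : ∀ᶠ z in 𝓝 (γ 0), Function.Injective (fderiv ℝ F z))
    (hγ : ∀ᶠ t in 𝓝 0, HasDerivAt γ (localField F u (γ t)) t)
    (hD : ∀ᶠ t in 𝓝 0, HasDerivAt D (fderiv ℝ (localField F u) (γ t) ∘L D t) t)
    (hD0 : D 0 = ContinuousLinearMap.id ℝ E) {p : ℕ} {e : Fin p → E}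
    (he : Orthonormal ℝ fun j => fderiv ℝ F (γ 0) (e j)) :
    ContDiffAt ℝ 2 (fun t => √(Matrix.of fun i j =>
      ⟪fderiv ℝ F (γ t) (D t (e i)), fderiv ℝ F (γ t) (D t (e j))⟫_ℝ).det) 0 ∧
    iteratedDeriv 2 (fun t => √(Matrix.of fun i j =>
      ⟪fderiv ℝ F (γ t) (D t (e i)), fderiv ℝ F (γ t) (D t (e j))⟫_ℝ).det) 0 =
    (∑ j, (⟪fderiv ℝ (fderiv ℝ (tangentProjection F)) (γ 0) (leftInverse (fderiv ℝ F (γ 0)) u)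
          (e j) u, fderiv ℝ F (γ 0) (e j)⟫_ℝ +
        ⟪fderiv ℝ (tangentProjection F) (γ 0)
          (fderiv ℝ (fun z => leftInverse (fderiv ℝ F z)) (γ 0) (e j) u) u,
          fderiv ℝ F (γ 0) (e j)⟫_ℝ +
        ‖fderiv ℝ (tangentProjection F) (γ 0) (e j) u‖ ^ 2)) -
      2 * ∑ j, ∑ k, ⟪u, fderiv ℝ (tangentProjection F) (γ 0) (e j)
        (fderiv ℝ F (γ 0) (e k))⟫_ℝ ^ 2 +
      (∑ j, ⟪u, fderiv ℝ (tangentProjection F) (γ 0) (e j) (fderiv ℝ F (γ 0) (e j))⟫_ℝ) ^ 2 := by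
  have hF0 := hF.self_of_nhds
  have hinj0 := hinj.self_of_nhds
  have H := isProjectionJet hF0 hinj
  have hcont : ContinuousAt γ 0 := hγ.self_of_nhds.continuousAt
  have hone : (Matrix.of fun i j => ⟪fderiv ℝ F (γ 0) (D 0 (e i)),
      fderiv ℝ F (γ 0) (D 0 (e j))⟫_ℝ) = 1 := by
    ext i j
    simp [hD0, orthonormal_iff_ite.mp he i j, Matrix.one_apply]
  constructor
  -- The pair (γ, D) solves one smooth autonomous equation, hence is smooth; the square root is
  -- harmless because the determinant is 1 at time 0.
  · have hΓ : ContDiffAt ℝ 2 (fun t => (γ t, D t)) 0 := by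
      refine contDiffAt_of_hasDerivAt (Z := variationField (localField F u))
        (contDiffAt_variationField (contDiffAt_localField hF0 hinj0 u)) ?_ 2
      filter_upwards [hγ, hD] with t h1 h2 using h1.prodMk h2
    have hw : ∀ j, ContDiffAt ℝ 2 (fun t => fderiv ℝ F (γ t) (D t (e j))) 0 := fun j =>
      (ContDiffAt.comp (0 : ℝ) (g := fderiv ℝ F) (f := γ)
        ((hF0.fderiv_right (m := ∞) (by simp)).of_le ENat.LEInfty.out) hΓ.fst).clm_apply
        (hΓ.snd.clm_apply contDiffAt_const)
    refine ContDiffAt.sqrt ?_ (by rw [hone]; simp)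
    simp only [Matrix.det_apply]
    refine ContDiffAt.sum fun σ _ => ContDiffAt.const_smul _ (contDiffAt_prod fun i _ => ?_)
    exact (hw _).inner ℝ (hw _)
  · have hw : ∀ᶠ t in 𝓝 0, ∀ j, HasDerivAt (fun t => fderiv ℝ F (γ t) (D t (e j)))
        (fderiv ℝ (tangentProjection F) (γ t) (D t (e j)) u) t := by
      filter_upwards [hcont.eventually hF, hcont.eventually hinj.eventually_nhds, hγ, hD]
        with t h1 h2 h3 h4 j
      exact hasDerivAt_pushforward h1 h2 h3 h4 (e j)
    have hw0 := hw.self_of_nhds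
    have hw' := fun j => hasDerivAt_fderiv_tangentProjection hF0 hinj0 hγ.self_of_nhds
      hD.self_of_nhds (e j)
    have h1 : ∀ i j, ⟪fderiv ℝ (tangentProjection F) (γ 0) (e i) u, fderiv ℝ F (γ 0) (e j)⟫_ℝ =
        ⟪u, fderiv ℝ (tangentProjection F) (γ 0) (e i) (fderiv ℝ F (γ 0) (e j))⟫_ℝ :=
      fun i j => H.inner_proj₁ _ _ _
    -- The required symmetry of the first-order motion is that of the second fundamental form,
    -- paired with `u`.
    rw [iteratedDeriv_two_sqrt_det_gram hw hw' (by simpa [hD0] using he) fun i j => by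
      simp only [hD0, ContinuousLinearMap.id_apply]
      rw [real_inner_comm, h1, h1, H.form_symm]]
    simp only [hD0, ContinuousLinearMap.id_apply, h1, inner_add_left]

end LocalSecondVariation

/-! ### From the manifold to a chart. -/

section Chart

variable {V : Type*} [NormedAddCommGroup V] [InnerProductSpace ℝ V]
  {E : Type*} [NormedAddCommGroup E] [NormedSpace ℝ E]
  {M : Type*} [TopologicalSpace M] [ChartedSpace E M]

/-- The expression of `f` in the chart at `x`. -/
def localRep (f : M → V) (x : M) : E → V := f ∘ (extChartAt 𝓘(ℝ, E) x).symm

/-- The differential at `y` of the chart at `x`. -/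
def chartDeriv (x y : M) : TangentSpace 𝓘(ℝ, E) y →L[ℝ] E :=
  mfderiv 𝓘(ℝ, E) 𝓘(ℝ, E) (extChartAt 𝓘(ℝ, E) x) y

variable [IsManifold 𝓘(ℝ, E) ∞ M] {f : M → V}

theorem contDiffAt_localRep (hf : ContMDiff 𝓘(ℝ, E) 𝓘(ℝ, V) ∞ f) (x : M) {z : E}
    (hz : z ∈ (extChartAt 𝓘(ℝ, E) x).target) : ContDiffAt ℝ ∞ (localRep f x) z := by
  have h : ContMDiffOn 𝓘(ℝ, E) 𝓘(ℝ, V) ∞ (localRep f x) (extChartAt 𝓘(ℝ, E) x).target :=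
    hf.comp_contMDiffOn (contMDiffOn_extChartAt_symm x)
  exact h.contDiffOn.contDiffAt ((isOpen_extChartAt_target x).mem_nhds hz)

theorem hasMFDerivAt_extChartAt_chartDeriv (x : M) {y : M} (hy : y ∈ (chartAt E x).source) :
    HasMFDerivAt 𝓘(ℝ, E) 𝓘(ℝ, E) (extChartAt 𝓘(ℝ, E) x) y (chartDeriv x y) :=
  (mdifferentiableAt_extChartAt hy).hasMFDerivAt

theorem chartDeriv_self (x : M) : chartDeriv x x = ContinuousLinearMap.id ℝ E :=
  mfderiv_extChartAt_self

theorem bijective_chartDeriv (x : M) {y : M} (hy : y ∈ (chartAt E x).source) :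
    Function.Bijective (chartDeriv (E := E) x y) :=
  (isInvertible_mfderiv_extChartAt (by simpa using hy)).bijective

theorem tangentMap_apply (hf : ContMDiff 𝓘(ℝ, E) 𝓘(ℝ, V) ∞ f) (x : M) {y : M}
    (hy : y ∈ (chartAt E x).source) (v : TangentSpace 𝓘(ℝ, E) y) :
    tangentMap f y v =
      fderiv ℝ (localRep f x) (extChartAt 𝓘(ℝ, E) x y) (chartDeriv x y v) := by
  have hy' : y ∈ (extChartAt 𝓘(ℝ, E) x).source := by simpa using hy
  have h1 := ((contDiffAt_localRep hf x
    ((extChartAt 𝓘(ℝ, E) x).map_source hy')).differentiableAt (by simp)).hasFDerivAt.hasMFDerivAt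
  have h2 := h1.comp y (hasMFDerivAt_extChartAt_chartDeriv x hy)
  have h3 : f =ᶠ[𝓝 y] localRep f x ∘ extChartAt 𝓘(ℝ, E) x := by
    filter_upwards [extChartAt_source_mem_nhds' hy'] with y' hy''
    exact congrArg f ((extChartAt 𝓘(ℝ, E) x).left_inv hy'').symm
  have h4 := (h2.congr_of_eventuallyEq h3).mfderiv
  rw [tangentMap, h4]
  rfl

theorem tangentMap_self (hf : ContMDiff 𝓘(ℝ, E) 𝓘(ℝ, V) ∞ f) (x : M) (X : E) :
    tangentMap (E := E) f x X = fderiv ℝ (localRep f x) (extChartAt 𝓘(ℝ, E) x x) X := by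
  have h := tangentMap_apply hf x (mem_chart_source E x) X
  rw [chartDeriv_self] at h
  exact h

theorem injective_fderiv_localRep (hf : IsInjectiveImmersion (E := E) f) (x : M) {z : E}
    (hz : z ∈ (extChartAt 𝓘(ℝ, E) x).target) :
    Function.Injective (fderiv ℝ (localRep f x) z) := by
  have key : ∀ y ∈ (chartAt E x).source,
      Function.Injective (fderiv ℝ (localRep f x) (extChartAt 𝓘(ℝ, E) x y)) := by
    intro y hy X Y hXY
    obtain ⟨X, rfl⟩ := (bijective_chartDeriv x hy).2 X
    obtain ⟨Y, rfl⟩ := (bijective_chartDeriv x hy).2 Y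
    rw [← tangentMap_apply hf.contMDiff x hy, ← tangentMap_apply hf.contMDiff x hy] at hXY
    rw [hf.injective_tangentMap _ hXY]
  have hy := (extChartAt 𝓘(ℝ, E) x).map_target hz
  rw [extChartAt_source] at hy
  have := key _ hy
  rwa [(extChartAt 𝓘(ℝ, E) x).right_inv hz] at this

theorem tangentSubspace_eq (hf : ContMDiff 𝓘(ℝ, E) 𝓘(ℝ, V) ∞ f) (x : M) {y : M}
    (hy : y ∈ (chartAt E x).source) :
    tangentSubspace (E := E) f y =
      (fderiv ℝ (localRep f x) (extChartAt 𝓘(ℝ, E) x y)).range := by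
  ext w
  constructor
  · rintro ⟨v, rfl⟩
    exact ⟨chartDeriv x y v, (tangentMap_apply hf x hy v).symm⟩
  · rintro ⟨X, rfl⟩
    obtain ⟨v, rfl⟩ := (bijective_chartDeriv x hy).2 X
    exact ⟨v, tangentMap_apply hf x hy v⟩

variable [FiniteDimensional ℝ V] [FiniteDimensional ℝ E]

/-- The injective differential of `localRep f x` sends both sides to the orthogonal projection of
`u` onto the same tangent space. -/
theorem chartDeriv_projField (hf : IsInjectiveImmersion (E := E) f) (u : V) (x : M) {y : M}
    (hy : y ∈ (chartAt E x).source) :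
    chartDeriv x y (projField f u y) =
      localField (localRep f x) u (extChartAt 𝓘(ℝ, E) x y) := by
  have hinj := injective_fderiv_localRep hf x
    ((extChartAt 𝓘(ℝ, E) x).map_source (by simpa using hy : y ∈ (extChartAt 𝓘(ℝ, E) x).source))
  apply hinj
  rw [← tangentMap_apply hf.contMDiff x hy, localField, apply_leftInverse hinj, projField,
    (exists_tangentMap_eq f u y).choose_spec]
  simp only [tangentSubspace_eq hf.contMDiff x hy]

/-- In the tangent bundle trivialisation at `x` the field is read as `localField`, which is smooth
although `projField` is defined by a pointwise choice. -/
theorem contMDiff_projField (hf : IsInjectiveImmersion (E := E) f) (u : V) :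
    ContMDiff 𝓘(ℝ, E) 𝓘(ℝ, E).tangent 1
      (fun y => (⟨y, projField f u y⟩ : TangentBundle 𝓘(ℝ, E) M)) := by
  intro x
  refine (Bundle.contMDiffAt_section x).mpr ?_
  have hx := mem_extChartAt_target (I := 𝓘(ℝ, E)) x
  have h1 : ContMDiffAt 𝓘(ℝ, E) 𝓘(ℝ, E) 1
      (fun y => localField (localRep f x) u (extChartAt 𝓘(ℝ, E) x y)) x :=
    ((contDiffAt_localField (contDiffAt_localRep hf.contMDiff x hx)
      (injective_fderiv_localRep hf x hx) u).of_le ENat.LEInfty.out).contMDiffAt.comp x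
      contMDiffAt_extChartAt
  refine h1.congr_of_eventuallyEq ?_
  filter_upwards [(chartAt E x).open_source.mem_nhds (mem_chart_source E x)] with y hy
  rw [← chartDeriv_projField hf u x hy, chartDeriv,
    ← TangentBundle.continuousLinearMapAt_trivializationAt hy]
  rw [Bundle.Trivialization.continuousLinearMapAt_apply,
    Bundle.Trivialization.coe_linearMapAt_of_mem _ hy]

/-- A solution of the local equation gives an integral curve in `M`. -/
theorem isMIntegralCurveOn_extChartAt_symm_comp (hf : IsInjectiveImmersion (E := E) f) (u : V)
    (x : M) {c : ℝ → E} {s : Set ℝ} (hs : ∀ t ∈ s, c t ∈ (extChartAt 𝓘(ℝ, E) x).target)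
    (hc : ∀ t ∈ s, HasDerivAt c (localField (localRep f x) u (c t)) t) :
    IsMIntegralCurveOn (I := 𝓘(ℝ, E)) (fun t => (extChartAt 𝓘(ℝ, E) x).symm (c t))
      (projField f u) s := by
  intro t ht
  have hz := hs t ht
  have hy := (extChartAt 𝓘(ℝ, E) x).map_target hz
  rw [extChartAt_source] at hy
  let w : E := localField (localRep f x) u (c t)
  let ℓ : ℝ →L[ℝ] E := (1 : ℝ →L[ℝ] ℝ).smulRight w
  have hℓ : HasFDerivAt c ℓ t := (hc t ht).hasFDerivAt.congr_fderiv (by ext; simp [ℓ, w])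
  have h1 : MDifferentiableAt 𝓘(ℝ, E) 𝓘(ℝ, E) (extChartAt 𝓘(ℝ, E) x).symm (c t) :=
    ((contMDiffOn_extChartAt_symm (n := 1) x).contMDiffAt
      ((isOpen_extChartAt_target x).mem_nhds hz)).mdifferentiableAt one_ne_zero
  have h3 := h1.hasMFDerivAt.comp t hℓ.hasMFDerivAt
  refine (h3.hasMFDerivWithinAt).congr_mfderiv ?_
  have h4 : mfderiv 𝓘(ℝ, E) 𝓘(ℝ, E) (extChartAt 𝓘(ℝ, E) x).symm (c t) w =
      projField f u ((extChartAt 𝓘(ℝ, E) x).symm (c t)) := by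
    apply (bijective_chartDeriv x hy).1
    rw [chartDeriv_projField hf u x hy, (extChartAt 𝓘(ℝ, E) x).right_inv hz]
    have h5 := mfderiv_extChartAt_comp_mfderivWithin_extChartAt_symm (I := 𝓘(ℝ, E)) hz
    simp only [modelWithCornersSelf_coe, range_id, mfderivWithin_univ] at h5
    exact DFunLike.congr_fun h5 w
  apply ContinuousLinearMap.ext
  intro (r : ℝ)
  exact (map_smul (mfderiv 𝓘(ℝ, E) 𝓘(ℝ, E) (extChartAt 𝓘(ℝ, E) x).symm (c t)) r w).trans
    (congrArg (fun v : E => r • v) h4)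

end Chart

/-! ### Second fundamental form, global flow and second variation on M. -/

section Flow

variable {V : Type*} [NormedAddCommGroup V] [InnerProductSpace ℝ V] [FiniteDimensional ℝ V]
  {E : Type*} [NormedAddCommGroup E] [NormedSpace ℝ E] [FiniteDimensional ℝ E]
  {M : Type*} [TopologicalSpace M] [ChartedSpace E M]
  [IsManifold 𝓘(ℝ, E) ∞ M] {f : M → V}

/-- The second fundamental form is the derivative of the projection onto the tangent space. -/
theorem secondFundamentalForm_eq (hf : IsInjectiveImmersion (E := E) f) (x : M) (X Y : E) :
    secondFundamentalForm (E := E) f x X Y =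
      fderiv ℝ (tangentProjection (localRep f x)) (extChartAt 𝓘(ℝ, E) x x) X
        (fderiv ℝ (localRep f x) (extChartAt 𝓘(ℝ, E) x x) Y) := by
  have hx := mem_extChartAt_target (I := 𝓘(ℝ, E)) x
  have hmem := (isOpen_extChartAt_target (I := 𝓘(ℝ, E)) x).mem_nhds hx
  have hF := contDiffAt_localRep hf.contMDiff x hx
  have H := isProjectionJet hF
    (by filter_upwards [hmem] with z hz using injective_fderiv_localRep hf x hz)
  have hA : DifferentiableAt ℝ (fderiv ℝ (localRep f x)) (extChartAt 𝓘(ℝ, E) x x) :=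
    (hF.fderiv_right (m := ∞) (by simp)).differentiableAt (by simp)
  have hB : fderiv ℝ (fun z => fderiv ℝ (localRep f x) z Y) (extChartAt 𝓘(ℝ, E) x x) X =
      fderiv ℝ (fderiv ℝ (localRep f x)) (extChartAt 𝓘(ℝ, E) x x) X Y := by
    rw [fderiv_clm_apply hA (differentiableAt_const Y)]
    simp
  -- Differentiating PA = A gives dP(X)(AY) = B(X,Y) - P B(X,Y), the normal part of B.
  rw [eq_sub_of_add_eq (H.proj_tangent₁ X Y),
    tangentProjection_eq (injective_fderiv_localRep hf x hx), ← hB]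
  change (tangentSubspace (E := E) f x)ᗮ.starProjection (fderiv ℝ
    (fun z => fderiv ℝ (localRep f x) z Y) (extChartAt 𝓘(ℝ, E) x x) X) = _
  rw [Submodule.starProjection_orthogonal_val]
  simp only [tangentSubspace_eq hf.contMDiff x (mem_chart_source E x)]

/-- The local flow of `projField f u`, in the chart at `x`. -/
theorem exists_localFlow_projField (hf : IsInjectiveImmersion (E := E) f) (u : V) (x : M) :
    ∃ ε > 0, ∃ N ∈ 𝓝 x, ∃ (Φ : E → ℝ → E) (D : ℝ → E →L[ℝ] E),
      (∀ y ∈ N, (extChartAt 𝓘(ℝ, E) x).symm (Φ (extChartAt 𝓘(ℝ, E) x y) 0) = y ∧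
        IsMIntegralCurveOn (I := 𝓘(ℝ, E))
          (fun t => (extChartAt 𝓘(ℝ, E) x).symm (Φ (extChartAt 𝓘(ℝ, E) x y) t))
          (projField f u) (Ioo (-ε) ε)) ∧
      Φ (extChartAt 𝓘(ℝ, E) x x) 0 = extChartAt 𝓘(ℝ, E) x x ∧
      D 0 = ContinuousLinearMap.id ℝ E ∧
      ∀ t ∈ Ioo (-ε) ε, Φ (extChartAt 𝓘(ℝ, E) x x) t ∈ (extChartAt 𝓘(ℝ, E) x).target ∧
        HasDerivAt (Φ (extChartAt 𝓘(ℝ, E) x x))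
          (localField (localRep f x) u (Φ (extChartAt 𝓘(ℝ, E) x x) t)) t ∧
        HasDerivAt D (fderiv ℝ (localField (localRep f x) u)
          (Φ (extChartAt 𝓘(ℝ, E) x x) t) ∘L D t) t ∧
        HasFDerivAt (fun z => Φ z t) (D t) (extChartAt 𝓘(ℝ, E) x x) := by
  have hx := mem_extChartAt_target (I := 𝓘(ℝ, E)) x
  obtain ⟨ε, hε, N, hN, Φ, D, hΦ, hD0, hD⟩ := exists_localFlow
    (contDiffAt_localField (contDiffAt_localRep hf.contMDiff x hx)
      (injective_fderiv_localRep hf x hx) u) ((isOpen_extChartAt_target x).mem_nhds hx)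
  have hΦx := hΦ _ (mem_of_mem_nhds hN)
  refine ⟨ε, hε, extChartAt 𝓘(ℝ, E) x ⁻¹' N ∩ (extChartAt 𝓘(ℝ, E) x).source,
    inter_mem ((continuousAt_extChartAt x).preimage_mem_nhds hN) (extChartAt_source_mem_nhds x),
    Φ, D, fun y hy => ⟨?_, ?_⟩, hΦx.1, hD0, fun t ht =>
      ⟨(hΦx.2 t ht).2, (hΦx.2 t ht).1, (hD t ht).1, (hD t ht).2⟩⟩
  · rw [(hΦ _ hy.1).1, (extChartAt 𝓘(ℝ, E) x).left_inv hy.2]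
  · exact isMIntegralCurveOn_extChartAt_symm_comp hf u x
      (fun t ht => ((hΦ _ hy.1).2 t ht).2) fun t ht => ((hΦ _ hy.1).2 t ht).1

variable [T2Space M] [CompactSpace M]

/-- On a compact manifold, `projField f u` is complete. -/
theorem exists_isMIntegralCurve_projField (hf : IsInjectiveImmersion (E := E) f) (u : V) (y : M) :
    ∃ γ : ℝ → M, γ 0 = y ∧ IsMIntegralCurve (I := 𝓘(ℝ, E)) γ (projField f u) := by
  -- A lifetime common to all starting points suffices for completeness. Having one is inherited by
  -- subsets and finite unions and holds near each point, so compactness gives it on M.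
  have huniform : ∃ ε > 0, ∀ y ∈ (univ : Set M), ∃ γ : ℝ → M, γ 0 = y ∧
      IsMIntegralCurveOn (I := 𝓘(ℝ, E)) γ (projField f u) (Ioo (-ε) ε) := by
    refine isCompact_univ.induction_on (p := fun S : Set M => ∃ ε > 0, ∀ y ∈ S, ∃ γ : ℝ → M,
      γ 0 = y ∧ IsMIntegralCurveOn (I := 𝓘(ℝ, E)) γ (projField f u) (Ioo (-ε) ε))
      ⟨1, one_pos, by simp⟩ ?_ ?_ ?_
    · rintro S T hST ⟨ε, hε, h⟩
      exact ⟨ε, hε, fun y hy => h y (hST hy)⟩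
    · rintro S T ⟨ε, hε, h⟩ ⟨δ, hδ, h'⟩
      refine ⟨min ε δ, lt_min hε hδ, ?_⟩
      rintro y (hy | hy)
      · obtain ⟨γ, hγ0, hγ⟩ := h y hy
        exact ⟨γ, hγ0, hγ.mono (Ioo_subset_Ioo (neg_le_neg (min_le_left _ _)) (min_le_left _ _))⟩
      · obtain ⟨γ, hγ0, hγ⟩ := h' y hy
        exact ⟨γ, hγ0, hγ.mono (Ioo_subset_Ioo (neg_le_neg (min_le_right _ _)) (min_le_right _ _))⟩
    · intro x _
      obtain ⟨ε, hε, N, hN, Φ, D, hΦ, -⟩ := exists_localFlow_projField hf u x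
      exact ⟨N, mem_nhdsWithin_of_mem_nhds hN, ε, hε, fun y hy =>
        ⟨fun t => (extChartAt 𝓘(ℝ, E) x).symm (Φ (extChartAt 𝓘(ℝ, E) x y) t), hΦ y hy⟩⟩
  obtain ⟨ε, hε, h⟩ := huniform
  exact exists_isMIntegralCurve_of_isMIntegralCurveOn (contMDiff_projField hf u) hε
    (fun y => h y (mem_univ y)) y

theorem flow_projField (hf : IsInjectiveImmersion (E := E) f) (u : V) (y : M) :
    flow (projField (E := E) f u) 0 y = y ∧ IsMIntegralCurve (I := 𝓘(ℝ, E))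
      (fun t => flow (projField (E := E) f u) t y) (projField f u) := by
  have h := exists_isMIntegralCurve_projField hf u y
  have hflow : (fun t => flow (projField (E := E) f u) t y) = h.choose := by
    ext t
    rw [flow, dif_pos h]
  rw [hflow]
  exact ⟨(congrFun hflow 0).trans h.choose_spec.1, h.choose_spec.2⟩

/-- Near time `0`, the frame transported by the flow of `projField f u`, as a frame in `V`. -/
theorem exists_pushforward_eq (hf : IsInjectiveImmersion (E := E) f) (u : V) (x : M) :
    ∃ (γ : ℝ → E) (D : ℝ → E →L[ℝ] E), γ 0 = extChartAt 𝓘(ℝ, E) x x ∧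
      D 0 = ContinuousLinearMap.id ℝ E ∧
      (∀ᶠ t in 𝓝 0, HasDerivAt γ (localField (localRep f x) u (γ t)) t) ∧
      (∀ᶠ t in 𝓝 0, HasDerivAt D (fderiv ℝ (localField (localRep f x) u) (γ t) ∘L D t) t) ∧
      ∀ᶠ t in 𝓝 0, ∀ X : E,
        tangentMap f (flow (projField (E := E) f u) t x)
          (mfderiv 𝓘(ℝ, E) 𝓘(ℝ, E) (flow (projField (E := E) f u) t) x X) =
        fderiv ℝ (localRep f x) (γ t) (D t X) := by
  obtain ⟨ε, hε, N, hN, Φ, D, hΦ, hΦ0, hD0, hD⟩ := exists_localFlow_projField hf u x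
  have hI : Ioo (-ε) ε ∈ 𝓝 (0 : ℝ) := Ioo_mem_nhds (neg_lt_zero.mpr hε) hε
  refine ⟨Φ (extChartAt 𝓘(ℝ, E) x x), D, hΦ0, hD0, ?_, ?_, ?_⟩
  · filter_upwards [hI] with t ht using (hD t ht).2.1
  · filter_upwards [hI] with t ht using (hD t ht).2.2.1
  filter_upwards [hI] with t ht X
  obtain ⟨htarget, -, -, hDt⟩ := hD t ht
  -- Regularity of `flow` in the starting point enters here: uniqueness of integral curves
  -- identifies it near `x` with the differentiable local flow.
  have heq : flow (projField (E := E) f u) t =ᶠ[𝓝 x]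
      (extChartAt 𝓘(ℝ, E) x).symm ∘ (fun z => Φ z t) ∘ extChartAt 𝓘(ℝ, E) x := by
    filter_upwards [hN] with y hy
    have hfl := flow_projField hf u y
    exact isMIntegralCurveOn_Ioo_eqOn_of_contMDiff_boundaryless (t₀ := 0) (a := -ε) (b := ε)
      ⟨neg_lt_zero.mpr hε, hε⟩ (contMDiff_projField hf u) (hfl.2.isMIntegralCurveOn _) (hΦ y hy).2
      (hfl.1.trans (hΦ y hy).1.symm) ht
  have hchart : HasMFDerivAt 𝓘(ℝ, E) 𝓘(ℝ, E) (extChartAt 𝓘(ℝ, E) x) x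
      (ContinuousLinearMap.id ℝ E) :=
    (hasMFDerivAt_extChartAt_chartDeriv x (mem_chart_source E x)).congr_mfderiv (chartDeriv_self x)
  have h1 := hDt.hasMFDerivAt.comp x hchart
  have hsymm : MDifferentiableAt 𝓘(ℝ, E) 𝓘(ℝ, E) (extChartAt 𝓘(ℝ, E) x).symm
      (((fun z => Φ z t) ∘ extChartAt 𝓘(ℝ, E) x) x) :=
    ((contMDiffOn_extChartAt_symm (n := 1) x).contMDiffAt
      ((isOpen_extChartAt_target x).mem_nhds htarget)).mdifferentiableAt one_ne_zero
  have hflow : MDifferentiableAt 𝓘(ℝ, E) 𝓘(ℝ, E) (flow (projField (E := E) f u) t) x :=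
    (hsymm.comp x h1.mdifferentiableAt).congr_of_eventuallyEq heq
  have hfd : MDifferentiableAt 𝓘(ℝ, E) 𝓘(ℝ, V) f (flow (projField (E := E) f u) t x) :=
    hf.contMDiff.mdifferentiableAt (by simp)
  have h2 := (((contDiffAt_localRep hf.contMDiff x htarget).differentiableAt
    (by simp)).hasFDerivAt.hasMFDerivAt).comp x h1
  -- The differential of `f ∘ flow` is computed twice, by the chain rule on M and through the chart,
  -- and the results are compared.
  have heq' : f ∘ flow (projField (E := E) f u) t =ᶠ[𝓝 x]
      localRep f x ∘ (fun z => Φ z t) ∘ extChartAt 𝓘(ℝ, E) x := heq.fun_comp f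
  have h3 := (h2.congr_of_eventuallyEq heq').mfderiv
  have h4 := mfderiv_comp x hfd hflow
  exact (DFunLike.congr_fun h4 X).symm.trans (DFunLike.congr_fun h3 X)

/-- The second variation along `projField f u` in terms of the projection onto the tangent space. -/
theorem secondVariation_projField (hf : IsInjectiveImmersion (E := E) f) (u : V) (x : M) {p : ℕ}
    (e : Fin p → TangentSpace 𝓘(ℝ, E) x) (he : Orthonormal ℝ fun j => tangentMap (E := E) f x (e j))
    {F : E → V} (hFe : F = localRep f x) {z₀ : E} (hz₀ : z₀ = extChartAt 𝓘(ℝ, E) x x)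
    {e' : Fin p → E} (he' : e' = e) :
    ContDiffAt ℝ 2 (pushforwardNorm f (projField (E := E) f u) x e) 0 ∧
    secondVariation f (projField (E := E) f u) x e =
    (∑ j, (⟪fderiv ℝ (fderiv ℝ (tangentProjection F)) z₀ (leftInverse (fderiv ℝ F z₀) u)
          (e' j) u, fderiv ℝ F z₀ (e' j)⟫_ℝ +
        ⟪fderiv ℝ (tangentProjection F) z₀
          (fderiv ℝ (fun z => leftInverse (fderiv ℝ F z)) z₀ (e' j) u) u,
          fderiv ℝ F z₀ (e' j)⟫_ℝ +
        ‖fderiv ℝ (tangentProjection F) z₀ (e' j) u‖ ^ 2)) -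
      2 * ∑ j, ∑ k, ⟪u, fderiv ℝ (tangentProjection F) z₀ (e' j) (fderiv ℝ F z₀ (e' k))⟫_ℝ ^ 2 +
      (∑ j, ⟪u, fderiv ℝ (tangentProjection F) z₀ (e' j) (fderiv ℝ F z₀ (e' j))⟫_ℝ) ^ 2 := by
  subst hFe he'
  obtain ⟨γ, D, hγ0, hD0, hγ, hD, hpush⟩ := exists_pushforward_eq hf u x
  have hmem := (isOpen_extChartAt_target (I := 𝓘(ℝ, E)) x).mem_nhds
    (mem_extChartAt_target (I := 𝓘(ℝ, E)) x)
  -- The base point is renamed `γ 0`, the form in which the chart formula is stated.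
  rw [← hγ0] at hz₀ hmem
  subst hz₀
  have key := iteratedDeriv_two_sqrt_det_pushforward (F := localRep f x) (γ := γ) (D := D) (u := u)
    (by filter_upwards [hmem] with z hz using contDiffAt_localRep hf.contMDiff x hz)
    (by filter_upwards [hmem] with z hz using injective_fderiv_localRep hf x hz) hγ hD hD0
    (e := e') (by
      rw [hγ0]
      simp only [← tangentMap_self hf.contMDiff]
      exact he)
  have heq : pushforwardNorm f (projField (E := E) f u) x e' =ᶠ[𝓝 0] fun t =>
      √(Matrix.of fun i j => ⟪fderiv ℝ (localRep f x) (γ t) (D t (e' i)),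
        fderiv ℝ (localRep f x) (γ t) (D t (e' j))⟫_ℝ).det := by
    filter_upwards [hpush] with t ht
    refine congrArg Real.sqrt (congrArg Matrix.det ?_)
    ext i j
    exact congrArg₂ _ (ht (e' i)) (ht (e' j))
  exact ⟨key.1.congr_of_eventuallyEq heq, heq.iteratedDeriv_eq 2 |>.trans key.2⟩

end Flow

end SymmetricOrbit

end

/-! ### The trace formula. -/

theorem mainTheorem2
    {V : Type*} [NormedAddCommGroup V] [InnerProductSpace ℝ V] [FiniteDimensional ℝ V]
    -- the Lie group `G` and its orthogonal representation on `V`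
    {EG : Type*} [NormedAddCommGroup EG] [NormedSpace ℝ EG] [FiniteDimensional ℝ EG]
    {G : Type*} [TopologicalSpace G] [ChartedSpace EG G] [Group G] [LieGroup 𝓘(ℝ, EG) ∞ G]
    (ρ : G →* (V ≃ₗᵢ[ℝ] V)) (hρ : ∀ w : V, Continuous fun g : G => ρ g w)
    -- the compact symmetric space `M = G/K`, embedded by `f` as the orbit of `v₀`
    {E : Type*} [NormedAddCommGroup E] [NormedSpace ℝ E] [FiniteDimensional ℝ E]
    {M : Type*} [TopologicalSpace M] [T2Space M] [CompactSpace M]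
    [ChartedSpace E M] [IsManifold 𝓘(ℝ, E) ∞ M]
    (f : M → V) (hf : SymmetricOrbit.IsInjectiveImmersion (E := E) f)
    (v₀ : V) (horbit : Set.range f = Set.range fun g : G => ρ g v₀)
    (hsymm : SymmetricOrbit.IsRiemannianSymmetric (E := E) f)
    -- the frame `e` at `x`, completed by `n` to an orthonormal basis of `T_x M`
    (x : M) {p q : ℕ}
    (e : Fin p → TangentSpace 𝓘(ℝ, E) x) (n : Fin q → TangentSpace 𝓘(ℝ, E) x)
    (horth : Orthonormal ℝ fun i : Fin p ⊕ Fin q =>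
      SymmetricOrbit.tangentMap (E := E) f x (Sum.elim e n i))
    (hspan : Submodule.span ℝ (Set.range (Sum.elim e n)) = ⊤)
    {ι : Type*} [Fintype ι] (b : OrthonormalBasis ι ℝ V) :
    (∀ (u : V) (y : M), SymmetricOrbit.flow (SymmetricOrbit.projField (E := E) f u) 0 y = y ∧
      IsMIntegralCurve (I := 𝓘(ℝ, E))
        (fun t => SymmetricOrbit.flow (SymmetricOrbit.projField (E := E) f u) t y)
        (SymmetricOrbit.projField (E := E) f u)) ∧
    (∀ u : V, ContDiffAt ℝ 2
      (SymmetricOrbit.pushforwardNorm f (SymmetricOrbit.projField (E := E) f u) x e) 0) ∧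
    ∑ i, SymmetricOrbit.secondVariation f (SymmetricOrbit.projField (E := E) f (b i)) x e =
      ∑ j, ∑ k,
        (2 * ‖SymmetricOrbit.secondFundamentalForm f x (e j) (n k)‖ ^ 2 -
          ⟪SymmetricOrbit.secondFundamentalForm f x (e j) (e j),
            SymmetricOrbit.secondFundamentalForm f x (n k) (n k)⟫_ℝ) := by
  have hF0 := SymmetricOrbit.contDiffAt_localRep hf.contMDiff x
    (mem_extChartAt_target (I := 𝓘(ℝ, E)) x)
  have H := SymmetricOrbit.isProjectionJet hF0 (by
    filter_upwards [(isOpen_extChartAt_target (I := 𝓘(ℝ, E)) x).mem_nhds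
      (mem_extChartAt_target (I := 𝓘(ℝ, E)) x)] with z hz
    exact SymmetricOrbit.injective_fderiv_localRep hf x hz)
  have he : Orthonormal ℝ fun j => SymmetricOrbit.tangentMap (E := E) f x (e j) :=
    horth.comp Sum.inl Sum.inl_injective
  refine ⟨SymmetricOrbit.flow_projField hf,
    fun u => (SymmetricOrbit.secondVariation_projField hf u x e he rfl rfl rfl).1, ?_⟩
  have hg : Orthonormal ℝ fun a : Fin p ⊕ Fin q =>
      fderiv ℝ (SymmetricOrbit.localRep f x) (extChartAt 𝓘(ℝ, E) x x) (Sum.elim e n a) := by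
    simp only [← SymmetricOrbit.tangentMap_self hf.contMDiff]
    exact horth
  refine (Finset.sum_congr rfl fun i _ =>
    (SymmetricOrbit.secondVariation_projField hf (b i) x e he rfl rfl rfl).2).trans
    ((H.sum_secondVariation b hg hspan).trans ?_)
  refine Finset.sum_congr rfl fun j _ => Finset.sum_congr rfl fun k _ => ?_
  exact (congrArg₂ (fun (v : V) (c : ℝ) => 2 * ‖v‖ ^ 2 - c)
    (SymmetricOrbit.secondFundamentalForm_eq hf x (e j) (n k))
    (congrArg₂ (fun v w : V => ⟪v, w⟫_ℝ)
      (SymmetricOrbit.secondFundamentalForm_eq hf x (e j) (e j))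
      (SymmetricOrbit.secondFundamentalForm_eq hf x (n k) (n k)))).symm
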